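/- Let $b^0,b^1,b^2,\dots$ be finite $0$-$1$ blocks, each of length at least $2$ and each beginning with $0$. For blocks $B$ and $C=C(0)\dots C(\ell-1)$ put $B\times C=B^{C(0)}B^{C(1)}\cdots B^{C(\ell-1)}$, where $B^0=B$ and $B^1$ is $B$ with $0$ and $1$ interchanged. Let $y=b^0\times b^1\times\cdots\in\{0,1\}^{\mathbb N}$ be the corresponding generalized Morse sequence, i.e. the sequence having every $b^0\times\cdots\times b^k$ as an initial block. Assume that $y$ is of Thue–Morse type: for every $m\ge 1$ there is $i$ such that $b^{i}=b^{i+1}=\dots=b^{i+m-1}=01$. Let $\mathcal O(y)\subset\{0,1\}^{\mathbb Z}$ be the set of all two-sided sequences each of whose finite blocks appears in $y$, let $T$ be the left shift on $\mathcal O(y)$, and let $\mu$ be a $T$-invariant Borel probability measure on $\mathcal O(y)$ (there is in fact exactly one). Let $\widetilde\eta$ be the continuous (atomless) part of a finite Borel measure on the circle $\mathbb S^1$ representing the maximal spectral type of the unitary operator $f\mapsto f\circ T$ on $L^2(\mathcal O(y),\mu)$, and for $m\in\mathbb N$ let $\widetilde\eta^{(m)}$ denote the image of $\widetilde\eta$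 under $z\mapsto z^m$. Then for all odd positive integers $r\ne s$ the measures $\widetilde\eta^{(r)}$ and $\widetilde\eta^{(s)}$ are mutually singular. -/

import Mathlib

open MeasureTheory

noncomputable section

namespace Morse

/-! ### Blocks and generalized Morse sequences

The symbols `0` and `1` are `false` and `true`; a block is a list of symbols. -/

/-- `B ^ c`: the block `B` if `c = 0`, and `B` with `0` and `1` interchanged if `c = 1`. -/
def blockPow (B : List Bool) (c : Bool) : List Bool :=
  if c then B.map (fun a => !a) else B

/-- `B × C = B ^ C(0) B ^ C(1) … B ^ C(l - 1)`. -/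
def blockMul (B C : List Bool) : List Bool :=
  C.flatMap (blockPow B)

/-- `b⁰ × b¹ × … × b^k`, bracketed from the left. -/
def blockProd (b : ℕ → List Bool) : ℕ → List Bool
  | 0 => b 0
  | k + 1 => blockMul (blockProd b k) (b (k + 1))

/-- `x = b⁰ × b¹ × …` is a generalized Morse sequence: every block `b^i` has length at least `2`
and begins with `0`, and every finite product `b⁰ × … × b^k` is an initial block of `x`. -/
structure IsMorseSequence (b : ℕ → List Bool) (x : ℕ → Bool) : Prop where
  two_le_length : ∀ i, 2 ≤ (b i).length
  head_eq : ∀ i, (b i)[0]? = some false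
  prefix_eq : ∀ k n, n < (blockProd b k).length → (blockProd b k)[n]? = some (x n)

/-- The blocks are of Thue-Morse type: for each `m ≥ 1` there are `m` consecutive
blocks equal to `01`. -/
def IsThueMorseType (b : ℕ → List Bool) : Prop :=
  ∀ m : ℕ, 1 ≤ m → ∃ i : ℕ, ∀ j < m, b (i + j) = [false, true]

/-! ### The associated dynamical system -/

/-- `𝒪(x)`: the two-sided sequences all of whose blocks appear in `x`. -/
def orbitSpace (x : ℕ → Bool) : Set (ℤ → Bool) :=
  {u | ∀ (a : ℤ) (l : ℕ), ∃ n : ℕ, ∀ j < l, u (a + j) = x (n + j)}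

/-- The left shift on two-sided sequences. -/
def shift : (ℤ → Bool) ≃ᵐ (ℤ → Bool) where
  toFun u i := u (i + 1)
  invFun u i := u (i - 1)
  left_inv u := by ext i; simp
  right_inv u := by ext i; simp
  measurable_toFun := by
    exact measurable_pi_lambda _ fun i => measurable_pi_apply (i + 1)
  measurable_invFun := by
    exact measurable_pi_lambda _ fun i => measurable_pi_apply (i - 1)

/-- `μ` is a shift-invariant Borel probability measure on `𝒪(x)`, regarded as a measure on
the space of all two-sided sequences that is carried by `𝒪(x)`. -/
structure IsInvariantMeasureOn (x : ℕ → Bool) (μ : Measure (ℤ → Bool)) : Prop where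
  isProbabilityMeasure : IsProbabilityMeasure μ
  measurePreserving : MeasurePreserving shift μ μ
  ae_mem : ∀ᵐ u ∂μ, u ∈ orbitSpace x

/-! ### Spectral measures -/

/-- The Koopman operator `f ↦ f ∘ T` on `L²(μ)` of an invertible measure-preserving map `T`,
as a unitary operator. -/
def koopman {X : Type*} [MeasurableSpace X] {μ : Measure X} (T : X ≃ᵐ X)
    (hT : MeasurePreserving T μ μ) : Lp ℂ 2 μ ≃ₗᵢ[ℂ] Lp ℂ 2 μ :=
  LinearIsometryEquiv.ofSurjective (Lp.compMeasurePreservingₗᵢ ℂ T hT) (by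
    intro g
    refine ⟨Lp.compMeasurePreserving T.symm (hT.symm T) g, ?_⟩
    change Lp.compMeasurePreserving T hT (Lp.compMeasurePreserving T.symm (hT.symm T) g) = g
    rw [← Lp.compMeasurePreserving_comp_apply]
    have h : (T.symm ∘ T : X → X) = id := by ext u; simp
    simp only [h]
    exact Lp.compMeasurePreserving_id_apply g)

/-- The circle carries its Borel `σ`-algebra. -/
instance instMeasurableSpaceCircle : MeasurableSpace Circle := borel Circle

instance instBorelSpaceCircle : BorelSpace Circle := ⟨rfl⟩

/-- `σ` is the spectral measure of the vector `ξ` for the unitary operator `U`: the finite Borel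
measure on the circle with `∫ z ^ m dσ(z) = ⟨U ^ m ξ, ξ⟩` for all `m ∈ ℤ` (the inner product of
Mathlib is linear in the second variable). -/
def IsSpectralMeasure {H : Type*} [NormedAddCommGroup H] [InnerProductSpace ℂ H]
    (U : H ≃ₗᵢ[ℂ] H) (ξ : H) (σ : Measure Circle) : Prop :=
  IsFiniteMeasure σ ∧ ∀ m : ℤ, ∫ z, ((z ^ m : Circle) : ℂ) ∂σ = inner ℂ ξ ((U ^ m) ξ)

/-- `ρ` represents the maximal spectral type of `U`: it is a finite Borel measure on the circle
that dominates all spectral measures of `U` and is equivalent to one of them. -/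
structure IsMaximalSpectralType {H : Type*} [NormedAddCommGroup H] [InnerProductSpace ℂ H]
    (U : H ≃ₗᵢ[ℂ] H) (ρ : Measure Circle) : Prop where
  isFiniteMeasure : IsFiniteMeasure ρ
  dominates : ∀ (ξ : H) (σ : Measure Circle), IsSpectralMeasure U ξ σ → σ ≪ ρ
  attained : ∃ (ξ : H) (σ : Measure Circle), IsSpectralMeasure U ξ σ ∧ ρ ≪ σ

/-- The continuous (atomless) part of a finite measure on the circle. -/
def continuousPart (ρ : Measure Circle) : Measure Circle :=
  ρ.restrict {z | ρ {z} = 0}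

/-- `ρ^(m)`: the image of `ρ` under `z ↦ z ^ m`. -/
def powImage (ρ : Measure Circle) (m : ℕ) : Measure Circle :=
  ρ.map (fun z => z ^ m)

end Morse

end

/-! The characters `chi l` span a dense subspace of L²(μ) and split by the parity of their degree.
Away from block ends, translating a character from one copy of the block b⁰ × … × b^k to another
only multiplies it by a power of the copy's sign, the exponent being the degree. Even characters
therefore almost repeat under all shifts by multiples of the block length. This makes them
orthogonal to every vector whose spectral measure does not charge roots of unity; since odd and even
characters are orthogonal, such a vector lies in the closed span of the odd ones.

When the k-th block is followed by a long run of factors 01, the signs of consecutive copies follow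
the Thue-Morse sequence up to a common sign. Shifting by q block lengths then multiplies inner
products of odd characters, in the limit, by the Thue-Morse autocorrelation γ(q). Hence, for
suitable block lengths N_i, the functions z^(q N_i) converge weakly to the constant γ(q) on the
continuous part of the maximal spectral type (`IsMorseSequence.exists_hasWeakLimit`).

On the image under z ↦ z^r the functions z^(m N_i) thus tend to γ(rm). Two measures on which the
same functions have different constant weak limits are mutually singular
(`mutuallySingular_of_hasWeakLimit`), so it suffices to find m with γ(rm) ≠ γ(sm)
(`exists_autocorr_mul_ne`). For s < r choose m with rm = 2^n - 1: then γ(rm) tends to 1/9 as n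
grows, while the binary expansion of sm repeats a nonconstant word and the recursion for γ contracts
γ(sm) to 0. -/

noncomputable section

namespace Morse

open Filter Topology
open scoped ENNReal

/-! ### The Thue-Morse sequence and its autocorrelation -/

/-- The Thue-Morse sequence with values `1` and `-1`. -/
def thueMorse : ℕ → ℝ
  | 0 => 1
  | n + 1 => (if (n + 1) % 2 = 0 then 1 else -1) * thueMorse ((n + 1) / 2)
decreasing_by omega

theorem thueMorse_zero : thueMorse 0 = 1 := by rw [thueMorse]

theorem thueMorse_two_mul (n : ℕ) : thueMorse (2 * n) = thueMorse n := by
  rcases n with _ | n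
  · rfl
  · rw [show 2 * (n + 1) = (2 * n + 1) + 1 by ring, thueMorse, if_pos (by omega),
      show (2 * n + 1 + 1) / 2 = n + 1 by omega, one_mul]

theorem thueMorse_two_mul_add_one (n : ℕ) : thueMorse (2 * n + 1) = -thueMorse n := by
  rw [thueMorse, if_neg (by omega), show (2 * n + 1) / 2 = n by omega, neg_one_mul]

theorem thueMorse_sq (n : ℕ) : thueMorse n * thueMorse n = 1 := by
  induction n using Nat.strong_induction_on with
  | _ n ih =>
    rcases Nat.even_or_odd' n with ⟨k, rfl | rfl⟩
    · rcases k with _ | k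
      · simp [thueMorse_zero]
      · rw [thueMorse_two_mul, ih _ (by omega)]
    · rw [thueMorse_two_mul_add_one, neg_mul_neg, ih _ (by omega)]

theorem abs_thueMorse (n : ℕ) : |thueMorse n| = 1 := by
  rcases mul_self_eq_one_iff.1 (thueMorse_sq n) with h | h <;> simp [h]

/-- A new leading binary digit 1 flips the sign. This is the form that matches B × 01, in which B is
followed by its complement. -/
theorem thueMorse_two_pow_add (j : ℕ) :
    ∀ p < 2 ^ j, thueMorse (2 ^ j + p) = -thueMorse p := by
  induction j with
  | zero =>
    intro p hp
    obtain rfl : p = 0 := by simpa using hp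
    simpa using thueMorse_two_mul_add_one 0
  | succ j ih =>
    intro p hp
    rw [pow_succ] at hp
    rcases Nat.even_or_odd' p with ⟨k, rfl | rfl⟩
    · rw [show 2 ^ (j + 1) + 2 * k = 2 * (2 ^ j + k) by ring, thueMorse_two_mul,
        thueMorse_two_mul, ih k (by omega)]
    · rw [show 2 ^ (j + 1) + (2 * k + 1) = 2 * (2 ^ j + k) + 1 by ring,
        thueMorse_two_mul_add_one, thueMorse_two_mul_add_one, ih k (by omega)]

/-- The autocorrelation of the first `2 ^ m` terms of the Thue-Morse sequence. -/
def corr (m q : ℕ) : ℝ :=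
  (∑ p ∈ Finset.range (2 ^ m), thueMorse p * thueMorse (p + q)) / 2 ^ m

theorem sum_range_two_mul (f : ℕ → ℝ) (n : ℕ) :
    ∑ p ∈ Finset.range (2 * n), f p = ∑ p ∈ Finset.range n, (f (2 * p) + f (2 * p + 1)) := by
  induction n with
  | zero => simp
  | succ n ih =>
    rw [show 2 * (n + 1) = 2 * n + 1 + 1 by ring, Finset.sum_range_succ, Finset.sum_range_succ,
      ih, Finset.sum_range_succ, add_assoc]

theorem corr_zero_right (m : ℕ) : corr m 0 = 1 := by
  simp [corr, thueMorse_sq]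

/-- Split the sum by the parity of p. The shifted factor may run past 2 ^ m, so this identity and
the next are exact, without boundary terms. -/
theorem corr_succ_two_mul (m q : ℕ) : corr (m + 1) (2 * q) = corr m q := by
  unfold corr
  rw [pow_succ' 2 m, sum_range_two_mul, pow_succ', ← div_div]
  congr 1
  rw [eq_comm, eq_div_iff two_ne_zero, Finset.sum_mul]
  refine Finset.sum_congr rfl fun p _ => ?_
  rw [show 2 * p + 2 * q = 2 * (p + q) by ring,
    show 2 * p + 1 + 2 * q = 2 * (p + q) + 1 by ring, thueMorse_two_mul, thueMorse_two_mul,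
    thueMorse_two_mul_add_one, thueMorse_two_mul_add_one]
  ring

theorem corr_succ_two_mul_add_one (m q : ℕ) :
    corr (m + 1) (2 * q + 1) = -(corr m q + corr m (q + 1)) / 2 := by
  unfold corr
  rw [pow_succ' 2 m, sum_range_two_mul, pow_succ', ← div_div, ← add_div, ← Finset.sum_add_distrib,
    ← neg_div, div_right_comm, ← Finset.sum_neg_distrib]
  congr 2
  refine Finset.sum_congr rfl fun p _ => ?_
  rw [show 2 * p + (2 * q + 1) = 2 * (p + q) + 1 by ring,
    show 2 * p + 1 + (2 * q + 1) = 2 * (p + (q + 1)) by ring, thueMorse_two_mul, thueMorse_two_mul,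
    thueMorse_two_mul_add_one, thueMorse_two_mul_add_one]
  ring

/-- At q = 1 the odd recursion refers back to q = 1, so the induction on q cannot reach this case.
It is solved explicitly as an affine recursion with fixed point -1/3. -/
theorem corr_one (m : ℕ) : corr m 1 = -1 / 3 - 2 / 3 * (-1 / 2) ^ m := by
  induction m with
  | zero =>
    have := thueMorse_two_mul_add_one 0
    norm_num [thueMorse_zero] at this
    norm_num [corr, this, thueMorse_zero]
  | succ m ih =>
    have := corr_succ_two_mul_add_one m 0
    simp only [mul_zero, zero_add, corr_zero_right] at this
    rw [this, ih, pow_succ]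
    ring

theorem exists_tendsto_corr (q : ℕ) : ∃ l, Tendsto (fun m => corr m q) atTop (𝓝 l) := by
  induction q using Nat.strong_induction_on with
  | _ q ih =>
    rcases Nat.even_or_odd' q with ⟨k, rfl | rfl⟩
    · rcases k with _ | k
      · exact ⟨1, by simp [corr_zero_right]⟩
      · obtain ⟨l, hl⟩ := ih (k + 1) (by omega)
        refine ⟨l, (tendsto_add_atTop_iff_nat 1).1 ?_⟩
        simpa only [corr_succ_two_mul] using hl
    · rcases k with _ | k
      · refine ⟨-1 / 3 - 2 / 3 * 0, ?_⟩
        simp only [mul_zero, zero_add, corr_one]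
        rw [show (-1 / 3 : ℝ) - 0 = -1 / 3 - 2 / 3 * 0 by ring]
        exact ((tendsto_pow_atTop_nhds_zero_of_abs_lt_one
          (by norm_num [abs_div])).const_mul _).const_sub _
      · obtain ⟨l, hl⟩ := ih (k + 1) (by omega)
        obtain ⟨l', hl'⟩ := ih (k + 1 + 1) (by omega)
        refine ⟨-(l + l') / 2, (tendsto_add_atTop_iff_nat 1).1 ?_⟩
        simpa only [corr_succ_two_mul_add_one] using (hl.add hl').neg.div_const 2

/-- The autocorrelation of the Thue-Morse sequence. -/
def autocorr (q : ℕ) : ℝ := (exists_tendsto_corr q).choose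

theorem tendsto_corr (q : ℕ) : Tendsto (fun m => corr m q) atTop (𝓝 (autocorr q)) :=
  (exists_tendsto_corr q).choose_spec

theorem autocorr_zero : autocorr 0 = 1 :=
  tendsto_nhds_unique (tendsto_corr 0) (by simp [corr_zero_right])

theorem autocorr_two_mul (q : ℕ) : autocorr (2 * q) = autocorr q :=
  tendsto_nhds_unique ((tendsto_add_atTop_iff_nat 1).2 (tendsto_corr (2 * q)))
    (by simpa only [corr_succ_two_mul] using tendsto_corr q)

theorem autocorr_two_mul_add_one (q : ℕ) :
    autocorr (2 * q + 1) = -(autocorr q + autocorr (q + 1)) / 2 :=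
  tendsto_nhds_unique ((tendsto_add_atTop_iff_nat 1).2 (tendsto_corr (2 * q + 1)))
    (by simpa only [corr_succ_two_mul_add_one] using
      ((tendsto_corr q).add (tendsto_corr (q + 1))).neg.div_const 2)

theorem autocorr_one : autocorr 1 = -1 / 3 := by
  have := autocorr_two_mul_add_one 0
  simp only [mul_zero, zero_add, autocorr_zero] at this
  linarith

theorem autocorr_two_pow (N : ℕ) : autocorr (2 ^ N) = -1 / 3 := by
  induction N with
  | zero => simpa using autocorr_one
  | succ N ih => rw [pow_succ', autocorr_two_mul, ih]

/-- Binary expansions consisting only of ones follow an eigendirection of the recursion with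
eigenvalue 1, so the values do not decay but tend to 1/9. -/
theorem autocorr_two_pow_sub_one (N : ℕ) :
    autocorr (2 ^ N - 1) = 1 / 9 + 8 / 9 * (-1 / 2) ^ N := by
  induction N with
  | zero => norm_num [autocorr_zero]
  | succ N ih =>
    have h : 1 ≤ 2 ^ N := Nat.one_le_two_pow
    rw [show 2 ^ (N + 1) - 1 = 2 * (2 ^ N - 1) + 1 by rw [pow_succ]; omega,
      autocorr_two_mul_add_one, ih, Nat.sub_add_cancel h, autocorr_two_pow, pow_succ]
    ring

/-- A norm of the vector `(autocorr n, autocorr (n + 1))` for which both matrices of the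
recursion are contractions. -/
def hexNorm (n : ℕ) : ℝ :=
  max (max |3 * autocorr n + autocorr (n + 1)| |autocorr n + 3 * autocorr (n + 1)|)
    (2 * |autocorr n - autocorr (n + 1)|)

theorem hexNorm_le_iff (n : ℕ) (C : ℝ) : hexNorm n ≤ C ↔
    (|3 * autocorr n + autocorr (n + 1)| ≤ C ∧ |autocorr n + 3 * autocorr (n + 1)| ≤ C) ∧
      2 * |autocorr n - autocorr (n + 1)| ≤ C := by
  simp [hexNorm]

theorem hexNorm_spec (n : ℕ) :
    (|3 * autocorr n + autocorr (n + 1)| ≤ hexNorm n ∧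
      |autocorr n + 3 * autocorr (n + 1)| ≤ hexNorm n) ∧
      2 * |autocorr n - autocorr (n + 1)| ≤ hexNorm n :=
  (hexNorm_le_iff n _).1 le_rfl

theorem abs_autocorr_le_hexNorm (n : ℕ) : |autocorr n| ≤ hexNorm n := by
  obtain ⟨⟨h1, h2⟩, h3⟩ := hexNorm_spec n
  rw [abs_le] at *
  constructor <;> linarith

theorem autocorr_two_mul_add_two (q : ℕ) : autocorr (2 * q + 2) = autocorr (q + 1) :=
  autocorr_two_mul (q + 1)

theorem hexNorm_two_mul (n : ℕ) : hexNorm (2 * n) ≤ hexNorm n := by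
  obtain ⟨⟨h1, h2⟩, h3⟩ := hexNorm_spec n
  rw [hexNorm_le_iff, autocorr_two_mul_add_one, autocorr_two_mul]
  have h3' : |autocorr n - autocorr (n + 1)| ≤ hexNorm n / 2 := by linarith
  refine ⟨⟨?_, ?_⟩, ?_⟩
  rotate_left 2
  · rw [← le_div_iff₀' two_pos]
    rw [abs_le] at *
    constructor <;> linarith
  all_goals
    rw [abs_le] at *
    constructor <;> linarith

theorem hexNorm_two_mul_add_one (n : ℕ) : hexNorm (2 * n + 1) ≤ hexNorm n := by
  obtain ⟨⟨h1, h2⟩, h3⟩ := hexNorm_spec n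
  rw [hexNorm_le_iff, autocorr_two_mul_add_one, autocorr_two_mul_add_two]
  have h3' : |autocorr n - autocorr (n + 1)| ≤ hexNorm n / 2 := by linarith
  refine ⟨⟨?_, ?_⟩, ?_⟩
  rotate_left 2
  · rw [← le_div_iff₀' two_pos]
    rw [abs_le] at *
    constructor <;> linarith
  all_goals
    rw [abs_le] at *
    constructor <;> linarith

/-- Each one-digit matrix has eigenvalue 1, so appending one digit need not contract strictly. The
eigenvectors for the digits 0 and 1 differ, and appending 01 (here) or 10 (next) gains the factor
3/4. -/
theorem hexNorm_four_mul_add_one (n : ℕ) : hexNorm (4 * n + 1) ≤ 3 / 4 * hexNorm n := by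
  obtain ⟨⟨h1, h2⟩, h3⟩ := hexNorm_spec n
  rw [hexNorm_le_iff, show 4 * n + 1 = 2 * (2 * n) + 1 by ring, autocorr_two_mul_add_one,
    autocorr_two_mul_add_two, autocorr_two_mul_add_one, autocorr_two_mul]
  have h3' : |autocorr n - autocorr (n + 1)| ≤ hexNorm n / 2 := by linarith
  refine ⟨⟨?_, ?_⟩, ?_⟩
  rotate_left 2
  · rw [← le_div_iff₀' two_pos]
    rw [abs_le] at *
    constructor <;> linarith
  all_goals
    rw [abs_le] at *
    constructor <;> linarith

theorem hexNorm_four_mul_add_two (n : ℕ) : hexNorm (4 * n + 2) ≤ 3 / 4 * hexNorm n := by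
  obtain ⟨⟨h1, h2⟩, h3⟩ := hexNorm_spec n
  rw [hexNorm_le_iff, show 4 * n + 2 = 2 * (2 * n + 1) by ring, autocorr_two_mul_add_one,
    autocorr_two_mul, show 2 * n + 1 + 1 = 2 * n + 2 by ring, autocorr_two_mul_add_two,
    autocorr_two_mul_add_one]
  have h3' : |autocorr n - autocorr (n + 1)| ≤ hexNorm n / 2 := by linarith
  refine ⟨⟨?_, ?_⟩, ?_⟩
  rotate_left 2
  · rw [← le_div_iff₀' two_pos]
    rw [abs_le] at *
    constructor <;> linarith
  all_goals
    rw [abs_le] at *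
    constructor <;> linarith

theorem hexNorm_two_pow_mul_add (p : ℕ) :
    ∀ a < 2 ^ p, ∀ n, hexNorm (2 ^ p * n + a) ≤ hexNorm n := by
  induction p with
  | zero => intro a ha n; simp at ha; simp [ha]
  | succ p ih =>
    intro a ha n
    rw [pow_succ] at ha
    rcases Nat.even_or_odd' a with ⟨k, rfl | rfl⟩
    · rw [show 2 ^ (p + 1) * n + 2 * k = 2 * (2 ^ p * n + k) by ring]
      exact (hexNorm_two_mul _).trans (ih k (by omega) n)
    · rw [show 2 ^ (p + 1) * n + (2 * k + 1) = 2 * (2 ^ p * n + k) + 1 by ring]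
      exact (hexNorm_two_mul_add_one _).trans (ih k (by omega) n)

/-- The bounds on a say that its p binary digits are not all equal, so 01 or 10 occurs somewhere
among them and contributes the factor 3/4; the other digits do no harm. -/
theorem hexNorm_two_pow_mul_add_le (p : ℕ) :
    ∀ a, 1 ≤ a → a + 2 ≤ 2 ^ p → ∀ n, hexNorm (2 ^ p * n + a) ≤ 3 / 4 * hexNorm n := by
  induction p with
  | zero => intro a _ h; simp at h
  | succ p ih =>
    intro a ha ha' n
    rw [pow_succ] at ha'
    have hp : 1 ≤ p := by
      by_contra! h
      obtain rfl : p = 0 := by omega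
      omega
    obtain ⟨p, rfl⟩ := Nat.exists_eq_add_of_le' hp
    have hpos : 1 ≤ 2 ^ p := Nat.one_le_two_pow
    rw [pow_succ] at ha'
    by_cases h : 1 ≤ a / 2 ∧ a / 2 + 2 ≤ 2 ^ (p + 1)
    · have := ih _ h.1 h.2 n
      rcases Nat.even_or_odd' a with ⟨k, hk⟩
      rw [show a / 2 = k by omega] at this
      rcases hk with rfl | rfl
      · rw [show 2 ^ (p + 1 + 1) * n + 2 * k = 2 * (2 ^ (p + 1) * n + k) by ring]
        exact (hexNorm_two_mul _).trans this
      · rw [show 2 ^ (p + 1 + 1) * n + (2 * k + 1) = 2 * (2 ^ (p + 1) * n + k) + 1 by ring]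
        exact (hexNorm_two_mul_add_one _).trans this
    · rw [pow_succ] at h
      -- If dropping the last digit leaves a constant word, the digits of a are 0…01 or 1…10, and
      -- the strict step is the last one.
      have : a = 1 ∨ a = 4 * (2 ^ p - 1) + 2 := by omega
      rcases this with rfl | rfl
      · rw [show 2 ^ (p + 1 + 1) * n + 1 = 4 * (2 ^ p * n + 0) + 1 by ring]
        have := hexNorm_two_pow_mul_add p 0 (by omega) n
        linarith [hexNorm_four_mul_add_one (2 ^ p * n + 0)]
      · rw [show 2 ^ (p + 1 + 1) * n + (4 * (2 ^ p - 1) + 2) = 4 * (2 ^ p * n + (2 ^ p - 1)) + 2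
          by ring]
        have := hexNorm_two_pow_mul_add p (2 ^ p - 1) (by omega) n
        linarith [hexNorm_four_mul_add_two (2 ^ p * n + (2 ^ p - 1))]

/-- The autocorrelations of the Thue-Morse sequence along the multiples of two different
odd numbers are different. -/
theorem exists_autocorr_mul_ne {r s : ℕ} (hr : Odd r) (hs : Odd s) (hsr : s < r) :
    ∃ m, autocorr (r * m) ≠ autocorr (s * m) := by
  by_contra! H
  have hr0 : 0 < r := by omega
  have hs0 : 0 < s := hs.pos
  set p := r.totient with hp
  have hp0 : 0 < p := Nat.totient_pos.2 hr0
  have hmod : 2 ^ p ≡ 1 [MOD r] := Nat.ModEq.pow_totient (Nat.coprime_two_left.2 hr)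
  obtain ⟨d, hd⟩ : r ∣ 2 ^ p - 1 :=
    (Nat.modEq_iff_dvd' Nat.one_le_two_pow).1 hmod.symm
  have h2p : 1 < 2 ^ p := Nat.one_lt_two_pow hp0.ne'
  have hd0 : 0 < d := Nat.pos_of_ne_zero (by rintro rfl; omega)
  have hsd : s * d < 2 ^ p - 1 := hd ▸ Nat.mul_lt_mul_of_pos_right hsr hd0
  -- With r d = 2 ^ p - 1, the expansion of M k repeats the p-digit word of d, so r * M k consists
  -- of p k ones. The expansion of s * M k repeats the word of s d, which is not constant because 0
  -- < s d < 2 ^ p - 1.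
  let M : ℕ → ℕ := fun k => Nat.rec 0 (fun _ x => 2 ^ p * x + d) k
  have hM : ∀ k, M (k + 1) = 2 ^ p * M k + d := fun k => rfl
  have hrM : ∀ k, r * M k = 2 ^ (p * k) - 1 := by
    intro k
    induction k with
    | zero => simp [M]
    | succ k ih =>
      have h1 : 1 ≤ 2 ^ (p * k) := Nat.one_le_two_pow
      rw [hM, mul_add, mul_left_comm, ih, ← hd, mul_add, mul_one, pow_add, mul_comm (2 ^ (p * k)),
        Nat.mul_sub]
      have : 2 ^ p * 1 ≤ 2 ^ p * 2 ^ (p * k) := Nat.mul_le_mul_left _ h1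
      omega
  have hsM : ∀ k, hexNorm (s * M k) ≤ (3 / 4) ^ k * hexNorm 0 := by
    intro k
    induction k with
    | zero => simp [M]
    | succ k ih =>
      rw [hM, mul_add, mul_left_comm]
      refine (hexNorm_two_pow_mul_add_le p (s * d) (Nat.mul_pos hs0 hd0) (by omega) _).trans ?_
      rw [pow_succ]
      linarith
  have h0 : Tendsto (fun k => autocorr (s * M k)) atTop (𝓝 0) := by
    refine squeeze_zero_norm (fun k => (abs_autocorr_le_hexNorm _).trans (hsM k)) ?_
    rw [show (0 : ℝ) = 0 * hexNorm 0 by ring]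
    exact (tendsto_pow_atTop_nhds_zero_of_lt_one (by norm_num) (by norm_num)).mul_const _
  have h1 : Tendsto (fun k => autocorr (s * M k)) atTop (𝓝 (1 / 9 + 8 / 9 * 0)) := by
    simp_rw [← H, hrM, autocorr_two_pow_sub_one]
    refine ((Tendsto.comp (g := fun n : ℕ => (-1 / 2 : ℝ) ^ n)
      (tendsto_pow_atTop_nhds_zero_of_abs_lt_one (by norm_num [abs_div]))
      (tendsto_id.const_mul_atTop' hp0)).const_mul _).const_add _
  have := tendsto_nhds_unique h0 h1
  norm_num at this

/-! ### The block structure of a generalized Morse sequence -/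

/-- The symbols `0` and `1` as the signs `1` and `-1`. -/
def sgn (c : Bool) : ℝ := if c then -1 else 1

theorem sgn_xor (c d : Bool) : sgn (c ^^ d) = sgn c * sgn d := by
  cases c <;> cases d <;> simp [sgn]

theorem sgn_not (c : Bool) : sgn (!c) = -sgn c := by
  cases c <;> simp [sgn]

theorem sgn_mul_self (c : Bool) : sgn c * sgn c = 1 := by
  cases c <;> simp [sgn]

theorem abs_sgn (c : Bool) : |sgn c| = 1 := by
  cases c <;> simp [sgn]

theorem length_blockPow (B : List Bool) (c : Bool) : (blockPow B c).length = B.length := by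
  cases c <;> simp [blockPow]

theorem getElem?_blockPow (B : List Bool) (c : Bool) (i : ℕ) :
    (blockPow B c)[i]? = B[i]?.map (c ^^ ·) := by
  cases c <;> simp [blockPow]

theorem length_blockMul (B C : List Bool) : (blockMul B C).length = C.length * B.length := by
  simp [blockMul, List.length_flatMap, length_blockPow]

theorem getElem?_blockMul (B C : List Bool) (p o : ℕ) (ho : o < B.length) :
    (blockMul B C)[p * B.length + o]? = C[p]?.bind fun c => B[o]?.map (c ^^ ·) := by
  induction C generalizing p with
  | nil => simp [blockMul]
  | cons c C ih =>
    have h : blockMul B (c :: C) = blockPow B c ++ blockMul B C := by simp [blockMul]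
    rw [h]
    rcases p with _ | p
    · rw [List.getElem?_append_left (by simpa [length_blockPow] using ho)]
      simp [getElem?_blockPow]
    · rw [List.getElem?_append_right (by rw [length_blockPow]; nlinarith), length_blockPow,
        show (p + 1) * B.length + o - B.length = p * B.length + o by
          rw [add_mul, one_mul, add_right_comm, Nat.add_sub_cancel], ih]
      simp

section MorseSequence

variable {b : ℕ → List Bool} {y : ℕ → Bool}

theorem IsMorseSequence.pow_two_le_length (hy : IsMorseSequence b y) (k : ℕ) :
    2 ^ (k + 1) ≤ (blockProd b k).length := by
  induction k with
  | zero => simpa [blockProd] using hy.two_le_length 0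
  | succ k ih =>
    rw [blockProd, length_blockMul, pow_succ']
    exact Nat.mul_le_mul (hy.two_le_length _) ih

theorem IsMorseSequence.length_pos (hy : IsMorseSequence b y) (k : ℕ) :
    0 < (blockProd b k).length :=
  (Nat.two_pow_pos _).trans_le (hy.pow_two_le_length k)

theorem IsMorseSequence.apply_zero (hy : IsMorseSequence b y) : y 0 = false := by
  have h := hy.prefix_eq 0 0 (hy.length_pos 0)
  rw [blockProd, hy.head_eq] at h
  simpa using h.symm

theorem IsMorseSequence.apply_mul_add_of_lt (hy : IsMorseSequence b y) (k p o : ℕ)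
    (hp : p < (b (k + 1)).length) (ho : o < (blockProd b k).length) :
    some (y (p * (blockProd b k).length + o)) = (b (k + 1))[p]?.map (· ^^ y o) := by
  have hlt : p * (blockProd b k).length + o < (blockProd b (k + 1)).length := by
    rw [blockProd, length_blockMul]
    nlinarith
  rw [← hy.prefix_eq _ _ hlt, blockProd, getElem?_blockMul _ _ _ _ ho, hy.prefix_eq _ _ ho,
    List.getElem?_eq_getElem hp]
  simp

/-- Multiplying on the right by another block keeps the prefix a concatenation of copies of the k-th
product and its complement; x / L is the index of the copy and x % L the offset in it. -/
theorem IsMorseSequence.apply_eq_xor (hy : IsMorseSequence b y) (k K : ℕ) (hkK : k ≤ K) :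
    ∀ x < (blockProd b K).length, y x =
      (y (x / (blockProd b k).length * (blockProd b k).length) ^^
        y (x % (blockProd b k).length)) := by
  have hL := hy.length_pos k
  induction K, hkK using Nat.le_induction with
  | base =>
    intro x hx
    rw [Nat.div_eq_of_lt hx, Nat.mod_eq_of_lt hx, zero_mul, hy.apply_zero, Bool.false_xor]
  | succ K hkK ih =>
    intro x hx
    have hK := hy.length_pos K
    have hdvd : (blockProd b k).length ∣ (blockProd b K).length := by
      clear hx ih hK
      induction K, hkK using Nat.le_induction with
      | base => exact dvd_rfl
      | succ K _ ih => rw [blockProd, length_blockMul]; exact ih.mul_left _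
    obtain ⟨d, hd⟩ := hdvd
    set L := (blockProd b k).length
    set M := (blockProd b K).length
    rw [blockProd, length_blockMul] at hx
    have hp : x / M < (b (K + 1)).length := Nat.div_lt_of_lt_mul (by rwa [mul_comm])
    have ho : x % M < M := Nat.mod_lt _ hK
    have key : ∀ o < M, y (x / M * M + o) = (y (x / M * M) ^^ y o) := by
      intro o ho
      have h1 := hy.apply_mul_add_of_lt K _ o hp ho
      have h2 := hy.apply_mul_add_of_lt K _ 0 hp hK
      rw [List.getElem?_eq_getElem hp] at h1 h2
      simp only [add_zero, hy.apply_zero, Option.map_some, Option.some_inj,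
        Bool.xor_false] at h1 h2
      change y (x / M * M + o) = _ at h1
      change y (x / M * M) = _ at h2
      rw [h1, h2]
    have hx' : x = x / M * M + x % M := (Nat.div_add_mod' x M).symm
    have hdiv : x / L * L = x / M * M + x % M / L * L := by
      have : x / L = x / M * d + x % M / L := by
        conv_lhs => rw [hx']
        rw [hd, show x / (L * d) * (L * d) + x % (L * d) = x % (L * d) + L * (x / (L * d) * d)
          by ring, Nat.add_mul_div_left _ _ hL, add_comm]
      rw [this, add_mul, hd]
      ring
    have hmod : x % L = x % M % L := (Nat.mod_mod_of_dvd x ⟨d, hd⟩).symm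
    rw [hdiv, hmod, key _ ((Nat.div_mul_le_self _ _).trans_lt ho)]
    conv_lhs => rw [hx', key _ ho, ih _ ho]
    rw [Bool.xor_assoc]

theorem IsMorseSequence.apply_mul_add (hy : IsMorseSequence b y) (k p o : ℕ)
    (ho : o < (blockProd b k).length) :
    y (p * (blockProd b k).length + o) = (y (p * (blockProd b k).length) ^^ y o) := by
  have hL := hy.length_pos k
  set x := p * (blockProd b k).length + o with hx
  -- Lengths at least double at each level, so level k + x already covers position x.
  have hlt : x < (blockProd b (k + x)).length :=
    calc x < 2 ^ x := Nat.lt_two_pow_self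
      _ ≤ 2 ^ (k + x + 1) := Nat.pow_le_pow_right two_pos (by omega)
      _ ≤ _ := hy.pow_two_le_length _
  have h := hy.apply_eq_xor k (k + x) (by omega) x hlt
  have h1 : x / (blockProd b k).length = p := by
    rw [hx, mul_comm, Nat.mul_add_div hL, Nat.div_eq_of_lt ho, add_zero]
  have h2 : x % (blockProd b k).length = o := by
    rw [hx, add_comm, Nat.add_mul_mod_self_right, Nat.mod_eq_of_lt ho]
  rwa [h1, h2] at h

/-- The signs of the initial symbols of consecutive blocks follow the Thue-Morse sequence as long
as the blocks of the product are equal to `01`. -/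
theorem IsMorseSequence.length_add_and_sgn (hy : IsMorseSequence b y) (k m : ℕ)
    (h : ∀ j < m, b (k + 1 + j) = [false, true]) :
    (blockProd b (k + m)).length = 2 ^ m * (blockProd b k).length ∧
      ∀ p < 2 ^ m, sgn (y (p * (blockProd b k).length)) = thueMorse p := by
  induction m with
  | zero =>
    refine ⟨by simp, fun p hp => ?_⟩
    obtain rfl : p = 0 := by simpa using hp
    simp [hy.apply_zero, sgn, thueMorse_zero]
  | succ m ih =>
    obtain ⟨h1, h2⟩ := ih fun j hj => h j (by omega)
    have hb : b (k + m + 1) = [false, true] := by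
      rw [← h m (by omega)]
      congr 1
      omega
    refine ⟨?_, fun p hp => ?_⟩
    · rw [← add_assoc, blockProd, length_blockMul, hb, h1, pow_succ']
      simp [mul_assoc]
    · rcases lt_or_ge p (2 ^ m) with hpm | hpm
      · exact h2 p hpm
      · obtain ⟨r, rfl⟩ := Nat.exists_eq_add_of_le hpm
        rw [pow_succ] at hp
        have hr : r < 2 ^ m := by omega
        have := hy.apply_mul_add_of_lt (k + m) 1 (r * (blockProd b k).length) (by simp [hb])
          (by rw [h1]; exact Nat.mul_lt_mul_of_pos_right hr (hy.length_pos k))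
        simp only [hb, h1, one_mul, List.getElem?_cons_succ, List.getElem?_cons_zero,
          Option.map_some, Option.some_inj, Bool.true_xor] at this
        rw [add_mul, this, sgn_not, h2 r hr, thueMorse_two_pow_add m r hr]

/-- There are arbitrarily long runs of blocks `01` starting arbitrarily late. -/
theorem IsThueMorseType.exists_run (hb : IsThueMorseType b) (m : ℕ) :
    ∃ k, m ≤ k ∧ ∀ j < m, b (k + 1 + j) = [false, true] := by
  -- Discarding the first m + 1 blocks of a run of length 2m + 1 leaves m blocks and forces k ≥ m.
  obtain ⟨i, hi⟩ := hb (2 * m + 1) (by omega)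
  refine ⟨i + m, by omega, fun j hj => ?_⟩
  rw [show i + m + 1 + j = i + (m + 1 + j) by omega]
  exact hi _ (by omega)

end MorseSequence

/-! ### Averages over an invariant measure -/

/-- The character `u ↦ ∏_{i ∈ l} (-1) ^ u(i)` of the group of two-sided sequences. -/
def chi (l : Multiset ℤ) (u : ℤ → Bool) : ℝ := (l.map fun i => sgn (u i)).prod

/-- Indexing by multisets makes products of characters correspond to sums, with no cancellation of
repeated indices to track; the parity of the degree stays additive. -/
theorem chi_add (l l' : Multiset ℤ) (u : ℤ → Bool) : chi (l + l') u = chi l u * chi l' u := by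
  simp [chi]

theorem chi_mul_self (l : Multiset ℤ) (u : ℤ → Bool) : chi l u * chi l u = 1 := by
  rw [chi, ← Multiset.prod_map_mul]
  simp [sgn_mul_self]

theorem abs_chi (l : Multiset ℤ) (u : ℤ → Bool) : |chi l u| = 1 := by
  rcases mul_self_eq_one_iff.1 (chi_mul_self l u) with h | h <;> simp [h]

theorem continuous_chi (l : Multiset ℤ) : Continuous (chi l) := by
  induction l using Multiset.induction_on with
  | empty =>
    have : chi 0 = fun _ => 1 := by ext u; simp [chi]
    rw [this]
    exact continuous_const
  | cons i l ih =>
    have : chi (i ::ₘ l) = fun u => sgn (u i) * chi l u := by ext u; simp [chi]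
    rw [this]
    exact (Continuous.comp (g := sgn) continuous_of_discreteTopology (continuous_apply i)).mul ih

theorem shift_iterate (n : ℕ) (u : ℤ → Bool) (i : ℤ) : (shift^[n] u) i = u (i + n) := by
  induction n generalizing i with
  | zero => simp
  | succ n ih =>
    rw [Function.iterate_succ_apply']
    change (shift^[n] u) (i + 1) = _
    rw [ih]
    congr 1
    push_cast
    ring

theorem chi_shift_iterate (l : Multiset ℤ) (n : ℕ) (u : ℤ → Bool) :
    chi l (shift^[n] u) = chi (l.map (· + (n : ℤ))) u := by
  simp [chi, shift_iterate]

/-- The two-sided sequence that starts at the position `P` of `y`. -/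
def fromPos (y : ℕ → Bool) (P : ℕ) : ℤ → Bool := fun j => y (P + j).toNat

/-- `Φ` depends only on the coordinates in `[-D, D]`. -/
def IsLocal (D : ℕ) (Φ : (ℤ → Bool) → ℝ) : Prop :=
  ∀ u v : ℤ → Bool, (∀ j : ℤ, |j| ≤ D → u j = v j) → Φ u = Φ v

theorem isLocal_chi (l : Multiset ℤ) (D : ℕ) (hl : ∀ i ∈ l, |i| ≤ D) : IsLocal D (chi l) := by
  intro u v h
  unfold chi
  congr 1
  exact Multiset.map_congr rfl fun i hi => by rw [h i (hl i hi)]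

theorem exists_radius (l : Multiset ℤ) : ∃ D : ℕ, ∀ i ∈ l, |i| ≤ D := by
  induction l using Multiset.induction_on with
  | empty => exact ⟨0, by simp⟩
  | cons i l ih =>
    obtain ⟨D, hD⟩ := ih
    refine ⟨max D i.natAbs, fun j hj => ?_⟩
    rcases Multiset.mem_cons.1 hj with rfl | hj
    · simp
    · exact (hD j hj).trans (by simp)

theorem integral_comp_shift_iterate {μ : Measure (ℤ → Bool)} (hμ : MeasurePreserving shift μ μ)
    {Φ : (ℤ → Bool) → ℝ} (hΦ : AEStronglyMeasurable Φ μ) (j : ℕ) :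
    ∫ u, Φ (shift^[j] u) ∂μ = ∫ u, Φ u ∂μ := by
  have hT := hμ.iterate j
  conv_rhs => rw [← hT.map_eq]
  rw [integral_map hT.aemeasurable (by rwa [hT.map_eq])]

/-- Replaces any ergodic theorem: invariance lets Φ be averaged over n shifts, and on 𝒪(y) such an
average sees only a finite window, which occurs in y. The condition D ≤ P keeps the window at
nonnegative positions, where the truncation in `fromPos` plays no role. -/
theorem abs_integral_sub_le_of_forall_average {y : ℕ → Bool} {μ : Measure (ℤ → Bool)}
    (hμ : IsInvariantMeasureOn y μ) {Φ : (ℤ → Bool) → ℝ} (hΦ : Integrable Φ μ) {D : ℕ}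
    (hloc : IsLocal D Φ) {n : ℕ} (hn : 0 < n) {κ ε : ℝ}
    (h : ∀ P : ℕ, D ≤ P →
      |(∑ j ∈ Finset.range n, Φ (fromPos y (P + j))) / n - κ| ≤ ε) :
    |∫ u, Φ u ∂μ - κ| ≤ ε := by
  have := hμ.isProbabilityMeasure
  have hT : ∀ j : ℕ, MeasurePreserving (shift^[j]) μ μ := fun j => hμ.measurePreserving.iterate j
  have hint : ∀ j : ℕ, Integrable (fun u => Φ (shift^[j] u)) μ := fun j =>
    (hT j).integrable_comp_of_integrable hΦ
  have hj := integral_comp_shift_iterate hμ.measurePreserving hΦ.aestronglyMeasurable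
  have hsum : ∫ u, ((∑ j ∈ Finset.range n, Φ (shift^[j] u)) / n - κ) ∂μ = ∫ u, Φ u ∂μ - κ := by
    rw [integral_sub ((integrable_finsetSum _ fun j _ => hint j).div_const _)
      (integrable_const _), integral_div, integral_finsetSum _ fun j _ => hint j]
    simp only [hj, Finset.sum_const, Finset.card_range, integral_const, probReal_univ]
    have : (n : ℝ) ≠ 0 := by positivity
    field_simp
    simp [mul_sub]
  rw [← hsum, ← Real.norm_eq_abs]
  refine (norm_integral_le_of_norm_le_const (C := ε) ?_).trans (by simp)
  filter_upwards [hμ.ae_mem] with u hu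
  obtain ⟨a, ha⟩ := hu (-D) (2 * D + n)
  have key : ∀ j < n, Φ (shift^[j] u) = Φ (fromPos y (a + D + j)) := by
    intro j hj
    refine hloc _ _ fun i hi => ?_
    rw [abs_le] at hi
    obtain ⟨t, ht⟩ := Int.eq_ofNat_of_zero_le (show 0 ≤ i + j + D by omega)
    rw [shift_iterate, fromPos, show i + (j : ℤ) = -D + t by omega, ha t (by omega)]
    congr 1
    push_cast
    omega
  rw [Real.norm_eq_abs, Finset.sum_congr rfl fun j hj => key j (Finset.mem_range.1 hj)]
  exact h _ (by omega)

theorem sum_range_add_of_periodic {g : ℕ → ℝ} {n : ℕ} (hg : Function.Periodic g n) (P : ℕ) :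
    ∑ j ∈ Finset.range n, g (P + j) = ∑ j ∈ Finset.range n, g j := by
  induction P with
  | zero => simp
  | succ P ih =>
    rw [← ih]
    have h := Finset.sum_range_succ (fun j => g (P + j)) n
    rw [Finset.sum_range_succ', hg P] at h
    simp only [add_zero, add_left_inj] at h
    rw [← h]
    exact Finset.sum_congr rfl fun j _ => by rw [add_right_comm, add_assoc]

/-- The average of a periodic function over a full period does not depend on the starting point, so
the uniformity in P is automatic. -/
theorem abs_integral_sub_le_of_periodic {y : ℕ → Bool} {μ : Measure (ℤ → Bool)}
    (hμ : IsInvariantMeasureOn y μ) {Φ : (ℤ → Bool) → ℝ} (hΦ : Integrable Φ μ) {D : ℕ}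
    (hloc : IsLocal D Φ) {n : ℕ} (hn : 0 < n) {g h : ℕ → ℝ} (hg : Function.Periodic g n)
    (hh : Function.Periodic h n) (H : ∀ x, D ≤ x → |Φ (fromPos y x) - g x| ≤ h x) :
    |∫ u, Φ u ∂μ - (∑ x ∈ Finset.range n, g x) / n| ≤ (∑ x ∈ Finset.range n, h x) / n := by
  refine abs_integral_sub_le_of_forall_average hμ hΦ hloc hn fun P hP => ?_
  rw [← sum_range_add_of_periodic hg P, ← sum_range_add_of_periodic hh P, ← sub_div,
    ← Finset.sum_sub_distrib, abs_div, Nat.abs_cast]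
  gcongr
  exact (Finset.abs_sum_le_sum_abs _ _).trans (Finset.sum_le_sum fun j _ => H _ (by omega))

theorem integrable_chi (l : Multiset ℤ) (μ : Measure (ℤ → Bool)) [IsFiniteMeasure μ] :
    Integrable (chi l) μ :=
  Integrable.of_bound (continuous_chi l).aestronglyMeasurable 1
    (ae_of_all _ fun u => (abs_chi l u).le)

/-! ### The characters along the block structure -/

/-- The positions in a block of length `L` that are close to its ends. -/
def IsNearEnd (D L o : ℕ) : Prop := o < D ∨ L ≤ o + D

open Classical in
theorem sum_isNearEnd_le (D L : ℕ) :
    ∑ o ∈ Finset.range L, (if IsNearEnd D L o then (1 : ℝ) else 0) ≤ 2 * D := by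
  rw [Finset.sum_boole]
  have : (Finset.range L).filter (IsNearEnd D L) ⊆
      Finset.range D ∪ (Finset.Ico (L - D) L) := by
    intro o ho
    simp only [IsNearEnd, Finset.mem_filter, Finset.mem_range, Finset.mem_union,
      Finset.mem_Ico] at ho ⊢
    omega
  have h := (Finset.card_le_card this).trans (Finset.card_union_le _ _)
  rw [Finset.card_range, Nat.card_Ico] at h
  have h' : ((Finset.range L).filter (IsNearEnd D L)).card ≤ 2 * D := by omega
  exact_mod_cast h'

theorem sum_range_mul (f : ℕ → ℝ) (M L : ℕ) :
    ∑ x ∈ Finset.range (M * L), f x =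
      ∑ p ∈ Finset.range M, ∑ o ∈ Finset.range L, f (p * L + o) := by
  induction M with
  | zero => simp
  | succ M ih => rw [add_mul, one_mul, Finset.sum_range_add, ih, Finset.sum_range_succ]

section MorseSequence

variable {b : ℕ → List Bool} {y : ℕ → Bool}

/-- Away from the ends all coordinates read by the character lie in the same copy of the block and
share its sign. Only the parity of the degree then matters, which separates even from odd
characters. -/
theorem IsMorseSequence.chi_fromPos (hy : IsMorseSequence b y) {l : Multiset ℤ} {D : ℕ}
    (hl : ∀ i ∈ l, |i| ≤ D) (k p o : ℕ)
    (hend : ¬IsNearEnd D (blockProd b k).length o) :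
    chi l (fromPos y (p * (blockProd b k).length + o)) =
      sgn (y (p * (blockProd b k).length)) ^ Multiset.card l * chi l (fromPos y o) := by
  rw [IsNearEnd, not_or, not_lt, not_le] at hend
  have : ∀ i ∈ l, sgn (fromPos y (p * (blockProd b k).length + o) i) =
      sgn (y (p * (blockProd b k).length)) * sgn (fromPos y o i) := by
    intro i hi
    have hi' := abs_le.1 (hl i hi)
    obtain ⟨t, ht⟩ := Int.eq_ofNat_of_zero_le (show 0 ≤ (o : ℤ) + i by omega)
    rw [fromPos, fromPos, ← sgn_xor, ← hy.apply_mul_add k p _ (by omega)]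
    congr 2
    push_cast
    rw [add_assoc, ht]
    norm_cast
  rw [chi, Multiset.map_congr rfl this, Multiset.prod_map_mul, Multiset.map_const',
    Multiset.prod_replicate, chi]

theorem fromPos_add (y : ℕ → Bool) (P t : ℕ) : fromPos y (P + t) = shift^[t] (fromPos y P) := by
  ext i
  rw [shift_iterate, fromPos, fromPos]
  congr 2
  push_cast
  ring

theorem sgn_pow_of_even (c : Bool) {n : ℕ} (hn : Even n) : sgn c ^ n = 1 := by
  obtain ⟨k, rfl⟩ := hn
  rw [← two_mul, pow_mul, sq, sgn_mul_self, one_pow]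

theorem sgn_pow_of_odd (c : Bool) {n : ℕ} (hn : Odd n) : sgn c ^ n = sgn c := by
  obtain ⟨k, rfl⟩ := hn
  rw [pow_succ, sgn_pow_of_even c (even_two_mul k), one_mul]

open Classical in
/-- Even characters are almost invariant under shifts by multiples of the block lengths. -/
theorem IsMorseSequence.one_sub_le_integral_chi (hy : IsMorseSequence b y)
    {μ : Measure (ℤ → Bool)} (hμ : IsInvariantMeasureOn y μ) {l : Multiset ℤ}
    (hl : Even (Multiset.card l)) {D : ℕ} (hD : ∀ i ∈ l, |i| ≤ D) (k j : ℕ) :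
    1 - 4 * D / (blockProd b k).length ≤
      ∫ u, chi (l + l.map (· + ((j * (blockProd b k).length : ℕ) : ℤ))) u ∂μ := by
  have := hμ.isProbabilityMeasure
  set L := (blockProd b k).length with hL
  have hL0 : 0 < L := hy.length_pos k
  obtain ⟨R, hR⟩ := exists_radius (l + l.map (· + ((j * L : ℕ) : ℤ)))
  have key := abs_integral_sub_le_of_periodic hμ (integrable_chi _ μ) (isLocal_chi _ R hR) hL0
    (g := fun _ => 1) (h := fun x => 2 * if IsNearEnd D L (x % L) then 1 else 0)
    (fun x => rfl) (fun x => by simp) (fun x _ => by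
      rw [chi_add, ← chi_shift_iterate, ← fromPos_add]
      split_ifs with hx
      · refine (abs_sub _ _).trans ?_
        rw [abs_mul, abs_chi, abs_chi]
        norm_num
      · have hlt := Nat.mod_lt x hL0
        have h1 := hy.chi_fromPos hD k (x / L) _ hx
        have h2 := hy.chi_fromPos hD k (x / L + j) _ hx
        rw [← hL] at h1 h2
        rw [sgn_pow_of_even _ hl, one_mul, Nat.div_add_mod'] at h1
        rw [sgn_pow_of_even _ hl, one_mul, add_mul, add_right_comm, Nat.div_add_mod'] at h2
        rw [h1, h2, chi_mul_self]
        simp)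
  rw [Finset.sum_const, Finset.card_range, nsmul_eq_mul, mul_one,
    div_self (by positivity), ← Finset.mul_sum,
    Finset.sum_congr rfl fun x hx => by rw [Nat.mod_eq_of_lt (Finset.mem_range.1 hx)]] at key
  have h2 := sum_isNearEnd_le D L
  have h3 : (2 * ∑ x ∈ Finset.range L, if IsNearEnd D L x then (1 : ℝ) else 0) / L ≤
      4 * D / L := by
    refine div_le_div_of_nonneg_right ?_ (by positivity)
    linarith
  linarith [(abs_le.1 key).1]

theorem abs_sum_range_le_one {f : ℕ → ℝ} (h1 : ∀ n, |f n| ≤ 1)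
    (h2 : ∀ n, f (2 * n + 1) = -f (2 * n)) (n : ℕ) : |∑ j ∈ Finset.range n, f j| ≤ 1 := by
  have : ∀ k, ∑ j ∈ Finset.range (2 * k), f j = 0 := fun k => by
    rw [sum_range_two_mul]
    simp [h2]
  rcases Nat.even_or_odd' n with ⟨k, rfl | rfl⟩
  · simp [this]
  · simpa [Finset.sum_range_succ, this] using h1 _

open Classical in
-- Average the character over M shifts by the block length. Consecutive copies come in pairs of
-- opposite sign, so the signs cancel up to an unpaired copy at either end, giving 2 / M; positions
-- near block ends give the other term.
theorem IsMorseSequence.abs_integral_chi_le (hy : IsMorseSequence b y)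
    {μ : Measure (ℤ → Bool)} (hμ : IsInvariantMeasureOn y μ) {l : Multiset ℤ}
    (hl : Odd (Multiset.card l)) {D : ℕ} (hD : ∀ i ∈ l, |i| ≤ D) (k : ℕ)
    (hk : b (k + 1) = [false, true]) {M : ℕ} (hM : 0 < M) :
    |∫ u, chi l u ∂μ| ≤ 2 / M + 2 * D / (blockProd b k).length := by
  have := hμ.isProbabilityMeasure
  set L := (blockProd b k).length with hL
  have hL0 : 0 < L := hy.length_pos k
  have hM0 : (M : ℝ) ≠ 0 := by positivity
  set Ψ : (ℤ → Bool) → ℝ := fun u => (∑ j ∈ Finset.range M, chi l (shift^[j * L] u)) / M with hΨ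
  have hT : ∀ j : ℕ, MeasurePreserving (shift^[j]) μ μ := fun j => hμ.measurePreserving.iterate j
  have hint : ∀ j : ℕ, Integrable (fun u => chi l (shift^[j * L] u)) μ := fun j =>
    (hT _).integrable_comp_of_integrable (integrable_chi l μ)
  have hΨint : Integrable Ψ μ := (integrable_finsetSum _ fun j _ => hint j).div_const _
  have hΨeq : ∫ u, Ψ u ∂μ = ∫ u, chi l u ∂μ := by
    have hj : ∀ j : ℕ, ∫ u, chi l (shift^[j * L] u) ∂μ = ∫ u, chi l u ∂μ := fun j =>
      integral_comp_shift_iterate hμ.measurePreserving (continuous_chi l).aestronglyMeasurable _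
    rw [hΨ, integral_div, integral_finsetSum _ fun j _ => hint j]
    simp only [hj, Finset.sum_const, Finset.card_range, nsmul_eq_mul]
    field_simp
  have hloc : IsLocal (D + M * L) Ψ := by
    intro u v huv
    simp only [hΨ]
    congr 1
    refine Finset.sum_congr rfl fun j hj => isLocal_chi l D hD _ _ fun i hi => ?_
    rw [shift_iterate, shift_iterate]
    refine huv _ ((abs_add_le _ _).trans ?_)
    rw [Nat.abs_cast]
    push_cast
    gcongr
    exact (Finset.mem_range.1 hj).le
  have hneg : ∀ n, sgn (y ((2 * n + 1) * L)) = -sgn (y (2 * n * L)) := by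
    obtain ⟨h1, h2⟩ := hy.length_add_and_sgn k 1 (by simpa using hk)
    intro n
    have h3 := h2 1 (by norm_num)
    have h4 := hy.apply_mul_add (k + 1) n L (by rw [h1, ← hL]; omega)
    rw [h1, ← hL] at h4
    rw [one_mul, ← hL, ← zero_add 1, ← mul_zero 2, thueMorse_two_mul_add_one, thueMorse_zero] at h3
    rw [show (2 * n + 1) * L = n * (2 ^ 1 * L) + L by ring, h4, sgn_xor, h3,
      show 2 * n * L = n * (2 ^ 1 * L) by ring]
    ring
  have hsum : ∀ p, |∑ j ∈ Finset.range M, sgn (y ((p + j) * L))| ≤ 2 := by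
    intro p
    have h := abs_sum_range_le_one (f := fun n => sgn (y (n * L))) (fun n => (abs_sgn _).le) hneg
    have h' : ∑ j ∈ Finset.range M, sgn (y ((p + j) * L)) =
        ∑ j ∈ Finset.range (p + M), sgn (y (j * L)) - ∑ j ∈ Finset.range p, sgn (y (j * L)) := by
      rw [Finset.sum_range_add]
      ring
    rw [h']
    exact (abs_sub _ _).trans (by linarith [h (p + M), h p])
  have key := abs_integral_sub_le_of_periodic hμ hΨint hloc hL0
    (g := fun _ => 0) (h := fun x => 2 / M + if IsNearEnd D L (x % L) then 1 else 0)
    (fun x => rfl) (fun x => by simp) (fun x _ => by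
      rw [sub_zero]
      simp only [hΨ, abs_div, Nat.abs_cast, ← fromPos_add]
      split_ifs with hx
      · have : |∑ j ∈ Finset.range M, chi l (fromPos y (x + j * L))| ≤ M := by
          refine (Finset.abs_sum_le_sum_abs _ _).trans ?_
          simp [abs_chi]
        have h1 : |∑ j ∈ Finset.range M, chi l (fromPos y (x + j * L))| / M ≤ 1 :=
          div_le_one_of_le₀ this (by positivity)
        have h2 : (0 : ℝ) ≤ 2 / M := by positivity
        linarith
      · have hlt := Nat.mod_lt x hL0
        have h1 : ∀ j, chi l (fromPos y (x + j * L)) =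
            sgn (y ((x / L + j) * L)) * chi l (fromPos y (x % L)) := fun j => by
          have h2 := hy.chi_fromPos hD k (x / L + j) _ hx
          rw [← hL] at h2
          rwa [sgn_pow_of_odd _ hl, add_mul, add_right_comm, Nat.div_add_mod', ← add_mul] at h2
        simp only [h1, ← Finset.sum_mul, abs_mul, abs_chi, mul_one, add_zero]
        gcongr
        exact hsum _)
  rw [Finset.sum_const_zero, zero_div, sub_zero, hΨeq, Finset.sum_add_distrib, Finset.sum_const,
    Finset.card_range, nsmul_eq_mul, add_div, mul_div_cancel_left₀ _ (by positivity),
    Finset.sum_congr rfl fun x hx => by rw [Nat.mod_eq_of_lt (Finset.mem_range.1 hx)]] at key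
  refine key.trans ?_
  gcongr
  exact sum_isNearEnd_le D L

/-- Odd characters have integral zero. -/
theorem IsMorseSequence.integral_chi_of_odd (hy : IsMorseSequence b y) (hb : IsThueMorseType b)
    {μ : Measure (ℤ → Bool)} (hμ : IsInvariantMeasureOn y μ) {l : Multiset ℤ}
    (hl : Odd (Multiset.card l)) : ∫ u, chi l u ∂μ = 0 := by
  obtain ⟨D, hD⟩ := exists_radius l
  have h : ∀ m : ℕ, |∫ u, chi l u ∂μ| ≤ (2 + 2 * D) * (1 / 2) ^ (m + 1) := by
    intro m
    obtain ⟨k, hk, hrun⟩ := hb.exists_run (m + 1)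
    refine (hy.abs_integral_chi_le hμ hl hD k (hrun 0 (by omega))
      (M := 2 ^ (m + 1)) (by positivity)).trans ?_
    rw [add_mul, one_div, inv_pow, ← div_eq_mul_inv, ← div_eq_mul_inv]
    have : (2 : ℝ) ^ (m + 1) ≤ (blockProd b k).length := by
      exact_mod_cast (Nat.pow_le_pow_right two_pos (by omega)).trans (hy.pow_two_le_length k)
    push_cast
    gcongr
  have h0 : Tendsto (fun m : ℕ => (2 + 2 * (D : ℝ)) * (1 / 2) ^ (m + 1)) atTop
      (𝓝 ((2 + 2 * D) * 0)) :=
    ((tendsto_add_atTop_iff_nat 1).2 (tendsto_pow_atTop_nhds_zero_of_lt_one (by norm_num)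
      (by norm_num))).const_mul _
  rw [mul_zero] at h0
  exact abs_eq_zero.1 (le_antisymm (ge_of_tendsto' h0 h) (abs_nonneg _))

open Classical in
-- At offset o of copy p the product factors into the signs of copies p and p + q and a local term
-- depending only on o. Inside a level k + m block these signs are Thue-Morse up to a common factor,
-- which squares to 1; averaging separates p from o.
theorem IsMorseSequence.abs_integral_chi_sub_le (hy : IsMorseSequence b y)
    {μ : Measure (ℤ → Bool)} (hμ : IsInvariantMeasureOn y μ) {l l' : Multiset ℤ}
    (hl : Odd (Multiset.card l)) (hl' : Odd (Multiset.card l')) {D : ℕ} (hD : ∀ i ∈ l, |i| ≤ D)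
    (hD' : ∀ i ∈ l', |i| ≤ D) (k m q : ℕ) (hrun : ∀ j < m, b (k + 1 + j) = [false, true]) :
    |∫ u, chi (l + l'.map (· + ((q * (blockProd b k).length : ℕ) : ℤ))) u ∂μ -
      corr m q * ((∑ o ∈ Finset.range (blockProd b k).length,
        chi l (fromPos y o) * chi l' (fromPos y o)) / (blockProd b k).length)| ≤
      4 * D / (blockProd b k).length + 2 * q / 2 ^ m := by
  have := hμ.isProbabilityMeasure
  obtain ⟨hlen, hsgn⟩ := hy.length_add_and_sgn k m hrun
  set L := (blockProd b k).length with hL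
  have hL0 : 0 < L := hy.length_pos k
  obtain ⟨R, hR⟩ := exists_radius (l + l'.map (· + ((q * L : ℕ) : ℤ)))
  set G : ℕ → ℕ → ℝ := fun p o => thueMorse p * thueMorse (p + q) *
    (chi l (fromPos y o) * chi l' (fromPos y o)) with hG
  -- The trivial bound 2 is paid where a window may cross a block end, or where copy p + q leaves
  -- the level k + m block and its sign is no longer controlled.
  set B : ℕ → ℕ → ℝ := fun p o => 2 * (if IsNearEnd D L o then 1 else 0) +
    2 * (if 2 ^ m ≤ p + q then 1 else 0) with hB
  have hdiv : ∀ p o, o < L → (p * L + o) / L = p := fun p o ho => by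
    rw [add_comm, Nat.add_mul_div_right _ _ hL0, Nat.div_eq_of_lt ho, zero_add]
  have hmod : ∀ p o, o < L → (p * L + o) % L = o := fun p o ho => by
    rw [add_comm, Nat.add_mul_mod_self_right, Nat.mod_eq_of_lt ho]
  have hper1 : ∀ x, (x + 2 ^ m * L) / L % 2 ^ m = x / L % 2 ^ m := fun x => by
    rw [Nat.add_mul_div_right _ _ hL0, Nat.add_mod_right]
  have hper2 : ∀ x, (x + 2 ^ m * L) % L = x % L := fun x => Nat.add_mul_mod_self_right _ _ _
  have key := abs_integral_sub_le_of_periodic hμ (integrable_chi _ μ) (isLocal_chi _ R hR)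
    (n := 2 ^ m * L) (by positivity)
    (g := fun x => G (x / L % 2 ^ m) (x % L)) (h := fun x => B (x / L % 2 ^ m) (x % L))
    (fun x => by simp only [hper1, hper2]) (fun x => by simp only [hper1, hper2]) (fun x _ => by
      rw [chi_add, ← chi_shift_iterate, ← fromPos_add]
      have htriv : |chi l (fromPos y x) * chi l' (fromPos y (x + q * L)) -
          G (x / L % 2 ^ m) (x % L)| ≤ 2 := by
        refine (abs_sub _ _).trans ?_
        simp only [hG, abs_mul, abs_chi, abs_thueMorse]
        norm_num
      by_cases hx : IsNearEnd D L (x % L)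
      · simp only [hB, if_pos hx]
        refine htriv.trans ?_
        split_ifs <;> norm_num
      by_cases hq : 2 ^ m ≤ x / L % 2 ^ m + q
      · simp only [hB, if_pos hq]
        refine htriv.trans ?_
        split_ifs; norm_num
      simp only [hB, if_neg hx, if_neg hq, hG]
      have hlt := Nat.mod_lt x hL0
      have hplt := Nat.mod_lt (x / L) (Nat.two_pow_pos m)
      have h1 := hy.chi_fromPos hD k (x / L) _ hx
      have h2 := hy.chi_fromPos hD' k (x / L + q) _ hx
      rw [← hL] at h1 h2
      rw [sgn_pow_of_odd _ hl, Nat.div_add_mod'] at h1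
      rw [sgn_pow_of_odd _ hl', add_mul, add_right_comm, Nat.div_add_mod', ← add_mul] at h2
      have h3 : ∀ p < 2 ^ m, sgn (y ((x / L / 2 ^ m * 2 ^ m + p) * L)) =
          sgn (y (x / L / 2 ^ m * (2 ^ m * L))) * thueMorse p := fun p hp => by
        have := hy.apply_mul_add (k + m) (x / L / 2 ^ m) (p * L)
          (by rw [hlen]; exact Nat.mul_lt_mul_of_pos_right hp hL0)
        rw [hlen] at this
        rw [add_mul, mul_assoc, this, sgn_xor, hsgn p hp]
      have h4 := h3 _ hplt
      have h5 := h3 _ (not_le.1 hq)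
      rw [Nat.div_add_mod'] at h4
      rw [← add_assoc, Nat.div_add_mod'] at h5
      rw [h1, h2, h4, h5]
      have h6 := sgn_mul_self (y (x / L / 2 ^ m * (2 ^ m * L)))
      refine le_of_eq ?_
      rw [mul_zero, add_zero, abs_eq_zero]
      linear_combination (thueMorse (x / L % 2 ^ m) * thueMorse (x / L % 2 ^ m + q) *
        (chi l (fromPos y (x % L)) * chi l' (fromPos y (x % L)))) * h6)
  have hred : ∀ F : ℕ → ℕ → ℝ, ∑ x ∈ Finset.range (2 ^ m * L), F (x / L % 2 ^ m) (x % L) =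
      ∑ p ∈ Finset.range (2 ^ m), ∑ o ∈ Finset.range L, F p o := fun F => by
    rw [sum_range_mul]
    refine Finset.sum_congr rfl fun p hp => Finset.sum_congr rfl fun o ho => ?_
    rw [Finset.mem_range] at hp ho
    rw [hdiv p o ho, hmod p o ho, Nat.mod_eq_of_lt hp]
  rw [hred G, hred B] at key
  have hL0' : (L : ℝ) ≠ 0 := by positivity
  have hGsum : (∑ p ∈ Finset.range (2 ^ m), ∑ o ∈ Finset.range L, G p o) / ((2 ^ m * L : ℕ) : ℝ) =
      corr m q * ((∑ o ∈ Finset.range L, chi l (fromPos y o) * chi l' (fromPos y o)) / L) := by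
    simp only [hG, ← Finset.mul_sum, ← Finset.sum_mul, corr]
    push_cast
    field_simp
  have hq : ∑ p ∈ Finset.range (2 ^ m), (if 2 ^ m ≤ p + q then (1 : ℝ) else 0) ≤ q := by
    rw [Finset.sum_boole]
    have : (Finset.range (2 ^ m)).filter (fun p => 2 ^ m ≤ p + q) ⊆
        Finset.Ico (2 ^ m - q) (2 ^ m) := by
      intro p hp
      simp only [Finset.mem_filter, Finset.mem_range, Finset.mem_Ico] at hp ⊢
      omega
    have h := Finset.card_le_card this
    rw [Nat.card_Ico] at h
    have h' : ((Finset.range (2 ^ m)).filter (fun p => 2 ^ m ≤ p + q)).card ≤ q := by omega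
    exact_mod_cast h'
  have hBsum : (∑ p ∈ Finset.range (2 ^ m), ∑ o ∈ Finset.range L, B p o) / ((2 ^ m * L : ℕ) : ℝ) ≤
      4 * D / L + 2 * q / 2 ^ m := by
    simp only [hB, Finset.sum_add_distrib, ← Finset.mul_sum, Finset.sum_const, Finset.card_range,
      nsmul_eq_mul]
    have h1 := sum_isNearEnd_le D L
    rw [div_le_iff₀ (by positivity)]
    have h2 : (4 * D / L + 2 * q / 2 ^ m) * ((2 ^ m * L : ℕ) : ℝ) =
        2 ^ m * (4 * D) + 2 * (L * q) := by
      push_cast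
      field_simp
    rw [h2]
    have h3 : (L : ℝ) * ∑ p ∈ Finset.range (2 ^ m), (if 2 ^ m ≤ p + q then (1 : ℝ) else 0) ≤
      L * q := by gcongr
    have h4 : (2 : ℝ) ^ m * ∑ o ∈ Finset.range L, (if IsNearEnd D L o then (1 : ℝ) else 0) ≤
      2 ^ m * (2 * D) := by gcongr
    push_cast
    linarith
  rw [hGsum] at key
  exact key.trans hBsum

/-- There is a sequence of times along which the correlations of the odd characters are multiplied
by the autocorrelations of the Thue-Morse sequence. -/
theorem IsMorseSequence.exists_tendsto_integral_chi (hy : IsMorseSequence b y)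
    (hb : IsThueMorseType b) {μ : Measure (ℤ → Bool)} (hμ : IsInvariantMeasureOn y μ) :
    ∃ N : ℕ → ℕ, ∀ (q : ℕ) (l l' : Multiset ℤ), Odd (Multiset.card l) → Odd (Multiset.card l') →
      Tendsto (fun i => ∫ u, chi (l + l'.map (· + ((q * N i : ℕ) : ℤ))) u ∂μ) atTop
        (𝓝 (autocorr q * ∫ u, chi (l + l') u ∂μ)) := by
  -- The i-th run has length at least i and its block has length at least 2 ^ i, so both error terms
  -- are O(2 ^ (-i)).
  choose K hK hrun using hb.exists_run
  refine ⟨fun i => (blockProd b (K i)).length, fun q l l' hl hl' => ?_⟩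
  obtain ⟨D, hD⟩ := exists_radius (l + l')
  set A : ℕ → ℝ := fun i => (∑ o ∈ Finset.range (blockProd b (K i)).length,
    chi l (fromPos y o) * chi l' (fromPos y o)) / (blockProd b (K i)).length with hA
  have hest : ∀ q i, |∫ u, chi (l + l'.map (· + ((q * (blockProd b (K i)).length : ℕ) : ℤ))) u ∂μ -
      corr i q * A i| ≤ (4 * D + 2 * q) * (1 / 2) ^ i := fun q i => by
    refine (hy.abs_integral_chi_sub_le hμ hl hl' (fun i hi => hD i (by simp [hi]))
      (fun i hi => hD i (by simp [hi])) (K i) i q (hrun i)).trans ?_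
    rw [add_mul, one_div, inv_pow, ← div_eq_mul_inv, ← div_eq_mul_inv]
    have : (2 : ℝ) ^ i ≤ (blockProd b (K i)).length := by
      exact_mod_cast (Nat.pow_le_pow_right two_pos ((hK i).trans (Nat.le_succ _))).trans
        (hy.pow_two_le_length _)
    gcongr
  have hzero : ∀ C : ℝ, Tendsto (fun i : ℕ => C * (1 / 2) ^ i) atTop (𝓝 0) := fun C => by
    simpa using (tendsto_pow_atTop_nhds_zero_of_lt_one (by norm_num)
      (by norm_num : (1 / 2 : ℝ) < 1)).const_mul C
  -- The case q = 0, in which the autocorrelation is 1, identifies the limit of the local averages.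
  have hAlim : Tendsto A atTop (𝓝 (∫ u, chi (l + l') u ∂μ)) := by
    rw [← tendsto_sub_nhds_zero_iff]
    refine squeeze_zero_norm (fun i => ?_) (hzero (4 * D + 2 * (0 : ℕ)))
    have := hest 0 i
    rw [corr_zero_right, one_mul] at this
    rw [Real.norm_eq_abs, abs_sub_comm]
    simpa using this
  have h1 := (tendsto_corr q).mul hAlim
  have h2 := squeeze_zero_norm (fun i => (Real.norm_eq_abs _).trans_le (hest q i))
    (hzero (4 * D + 2 * q))
  simpa using h2.add h1

end MorseSequence

/-! ### Trigonometric polynomials on the circle -/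

/-- The function `z ↦ z ^ m` on the circle. -/
def mono (m : ℤ) : C(Circle, ℂ) :=
  ⟨fun z => ((z ^ m : Circle) : ℂ), continuous_subtype_val.comp (continuous_zpow m)⟩

theorem mono_apply (m : ℤ) (z : Circle) : mono m z = ((z ^ m : Circle) : ℂ) := rfl

theorem norm_mono (m : ℤ) (z : Circle) : ‖mono m z‖ = 1 := Circle.norm_coe _

theorem mono_add (m n : ℤ) (z : Circle) : mono (m + n) z = mono m z * mono n z := by
  simp [mono_apply, zpow_add]

theorem star_mono (m : ℤ) (z : Circle) : star (mono m z) = mono (-m) z := by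
  rw [mono_apply, mono_apply, zpow_neg, Circle.coe_inv_eq_conj]
  rfl

/-- The trigonometric polynomial with given coefficients. -/
def trigPoly : (ℤ →₀ ℂ) →ₗ[ℂ] C(Circle, ℂ) := Finsupp.linearCombination ℂ mono

theorem trigPoly_single (m : ℤ) (a : ℂ) : trigPoly (Finsupp.single m a) = a • mono m := by
  simp [trigPoly]

/-- The star subalgebra of the trigonometric polynomials. -/
def trigSubalgebra : StarSubalgebra ℂ C(Circle, ℂ) where
  carrier := LinearMap.range trigPoly
  add_mem' := Submodule.add_mem _
  zero_mem' := Submodule.zero_mem _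
  algebraMap_mem' a := ⟨Finsupp.single 0 a, by
    rw [trigPoly_single]
    ext z
    simp [mono_apply]⟩
  mul_mem' := by
    rintro _ _ ⟨p, rfl⟩ ⟨q, rfl⟩
    induction p using Finsupp.induction_linear with
    | zero => simp
    | add p p' h h' => rw [map_add, add_mul]; exact Submodule.add_mem _ h h'
    | single m a =>
      induction q using Finsupp.induction_linear with
      | zero => simp
      | add p p' h h' => rw [map_add, mul_add]; exact Submodule.add_mem _ h h'
      | single n c =>
        refine ⟨Finsupp.single (m + n) (a * c), ?_⟩
        rw [trigPoly_single, trigPoly_single, trigPoly_single]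
        ext z
        simp only [ContinuousMap.smul_apply, ContinuousMap.mul_apply, mono_add, smul_eq_mul]
        ring
  star_mem' := by
    rintro _ ⟨p, rfl⟩
    induction p using Finsupp.induction_linear with
    | zero => simp
    | add p p' h h' => rw [map_add, star_add]; exact Submodule.add_mem _ h h'
    | single m a =>
      refine ⟨Finsupp.single (-m) (star a), ?_⟩
      rw [trigPoly_single, trigPoly_single]
      ext z
      simp only [ContinuousMap.smul_apply, ContinuousMap.star_apply, smul_eq_mul, star_mul',
        star_mono]

theorem denseRange_trigPoly : DenseRange trigPoly := by
  have h := ContinuousMap.starSubalgebra_topologicalClosure_eq_top_of_separatesPoints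
    trigSubalgebra (fun z w hzw => ⟨_, ⟨mono 1, ⟨Finsupp.single 1 1, by
      rw [trigPoly_single, one_smul]⟩, rfl⟩, by
        simpa [mono_apply, Circle.coe_inj] using hzw⟩)
  intro f
  have hf : f ∈ trigSubalgebra.topologicalClosure := h ▸ StarSubalgebra.mem_top
  exact hf

/-- Trigonometric polynomials as elements of `L^p`. -/
def trigLp (p : ℝ≥0∞) [Fact (1 ≤ p)] (σ : Measure Circle) [IsFiniteMeasure σ] :
    (ℤ →₀ ℂ) →ₗ[ℂ] Lp ℂ p σ :=
  (ContinuousMap.toLp p σ ℂ : C(Circle, ℂ) →L[ℂ] Lp ℂ p σ).toLinearMap ∘ₗ trigPoly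

theorem denseRange_trigLp (p : ℝ≥0∞) [Fact (1 ≤ p)] (hp : p ≠ ∞) (σ : Measure Circle)
    [IsFiniteMeasure σ] : DenseRange (trigLp p σ) :=
  (ContinuousMap.toLp_denseRange ℂ σ ℂ hp).comp denseRange_trigPoly
    (ContinuousLinearMap.continuous _)

/-! ### The cyclic subspace of a vector with a spectral measure -/

section Spectral

variable {H : Type*} [NormedAddCommGroup H] [InnerProductSpace ℂ H] {U : H ≃ₗᵢ[ℂ] H} {ξ : H}
  {σ : Measure Circle}

theorem zpow_add_apply (U : H ≃ₗᵢ[ℂ] H) (m n : ℤ) (x : H) :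
    (U ^ (m + n)) x = (U ^ m) ((U ^ n) x) := by
  rw [zpow_add]; rfl

theorem inner_zpow_zpow (U : H ≃ₗᵢ[ℂ] H) (m n : ℤ) (x y : H) :
    inner ℂ ((U ^ m) x) ((U ^ n) y) = inner ℂ x ((U ^ (n - m)) y) := by
  rw [show n = m + (n - m) by ring, zpow_add_apply, LinearIsometryEquiv.inner_map_map,
    add_sub_cancel_left]

/-- A trigonometric polynomial of a unitary operator, applied to a vector. -/
def trigVec (U : H ≃ₗᵢ[ℂ] H) (ξ : H) : (ℤ →₀ ℂ) →ₗ[ℂ] H :=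
  Finsupp.linearCombination ℂ fun m : ℤ => (U ^ m) ξ

theorem trigVec_single (m : ℤ) (a : ℂ) :
    trigVec U ξ (Finsupp.single m a) = a • (U ^ m) ξ := by
  simp [trigVec]

theorem integrable_continuousMap [IsFiniteMeasure σ] (f : C(Circle, ℂ)) : Integrable f σ :=
  Integrable.of_bound f.continuous.aestronglyMeasurable ‖f‖ (ae_of_all _ f.norm_coe_le_norm)

theorem IsSpectralMeasure.inner_trigVec (h : IsSpectralMeasure U ξ σ) (p q : ℤ →₀ ℂ) :
    inner ℂ (trigVec U ξ p) (trigVec U ξ q) = ∫ z, star (trigPoly p z) * trigPoly q z ∂σ := by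
  have := h.1
  have hint : ∀ f g : C(Circle, ℂ), Integrable (fun z => star (f z) * g z) σ := fun f g =>
    integrable_continuousMap (star f * g)
  induction p using Finsupp.induction_linear with
  | zero => simp
  | add p p' hp hp' =>
    rw [map_add, inner_add_left, hp, hp', ← integral_add (hint _ _) (hint _ _)]
    congr with z
    simp [add_mul]
  | single m a =>
    induction q using Finsupp.induction_linear with
    | zero => simp
    | add q q' hq hq' =>
      rw [map_add, inner_add_right, hq, hq', ← integral_add (hint _ _) (hint _ _)]
      congr with z
      simp [mul_add]
    | single n c =>
      rw [trigVec_single, trigVec_single, inner_smul_left, inner_smul_right, inner_zpow_zpow,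
        ← h.2, trigPoly_single, trigPoly_single, ← integral_const_mul, ← integral_const_mul]
      congr with z
      have h1 := mono_add (-m) n z
      rw [neg_add_eq_sub] at h1
      change _ * (_ * mono (n - m) z) = _
      simp only [ContinuousMap.smul_apply, smul_eq_mul, star_mul', star_mono, h1]
      change star a * _ = _
      ring

theorem IsSpectralMeasure.norm_trigVec [IsFiniteMeasure σ] (h : IsSpectralMeasure U ξ σ)
    (p : ℤ →₀ ℂ) : ‖trigVec U ξ p‖ = ‖trigLp 2 σ p‖ := by
  rw [@norm_eq_sqrt_re_inner ℂ, @norm_eq_sqrt_re_inner ℂ, h.inner_trigVec]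
  congr 2
  rw [trigLp]
  simp only [LinearMap.comp_apply, ContinuousLinearMap.coe_coe]
  rw [ContinuousMap.inner_toLp]
  congr with z
  simp [mul_comm]

/-- The isometric embedding of `L²(σ)` onto the cyclic subspace of a vector `ξ` with spectral
measure `σ`. -/
def cyclicMap [CompleteSpace H] [IsFiniteMeasure σ] (h : IsSpectralMeasure U ξ σ) :
    Lp ℂ 2 σ →ₗᵢ[ℂ] H where
  toLinearMap := ((trigVec U ξ).extendOfNorm (trigLp 2 σ)).toLinearMap
  norm_map' f := by
    refine (denseRange_trigLp 2 (by norm_num) σ).induction (P := fun f =>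
      ‖(trigVec U ξ).extendOfNorm (trigLp 2 σ) f‖ = ‖f‖) ?_
      (isClosed_eq (by fun_prop) (by fun_prop)) f
    rintro _ ⟨p, rfl⟩
    rw [LinearMap.extendOfNorm_eq (denseRange_trigLp 2 (by norm_num) σ)
      ⟨1, fun p => by rw [one_mul, h.norm_trigVec]⟩, h.norm_trigVec]

theorem cyclicMap_trigLp [CompleteSpace H] [IsFiniteMeasure σ] (h : IsSpectralMeasure U ξ σ)
    (p : ℤ →₀ ℂ) : cyclicMap h (trigLp 2 σ p) = trigVec U ξ p :=
  LinearMap.extendOfNorm_eq (denseRange_trigLp 2 (by norm_num) σ)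
    ⟨1, fun p => by rw [one_mul, h.norm_trigVec]⟩ p

/-- Multiplication by `z ^ m` on `L²(σ)`. -/
def mulMono (σ : Measure Circle) [IsFiniteMeasure σ] (m : ℤ) : Lp ℂ 2 σ →L[ℂ] Lp ℂ 2 σ :=
  (ContinuousLinearMap.mul ℂ ℂ).holderL σ ∞ 2 2 (ContinuousMap.toLp ∞ σ ℂ (mono m))

theorem coeFn_mulMono [IsFiniteMeasure σ] (m : ℤ) (f : Lp ℂ 2 σ) :
    mulMono σ m f =ᵐ[σ] fun z => mono m z * f z := by
  filter_upwards [(ContinuousLinearMap.mul ℂ ℂ).coeFn_holder (r := 2)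
    (ContinuousMap.toLp ∞ σ ℂ (mono m) : Lp ℂ ∞ σ) f,
    ContinuousMap.coeFn_toLp (p := ∞) (𝕜 := ℂ) σ (mono m)] with z h1 h2
  change ((ContinuousLinearMap.mul ℂ ℂ).holder 2 _ f) z = _
  rw [h1, h2]
  rfl

/-- The embedding intertwines multiplication by z ^ m with U ^ m; this is checked on trigonometric
polynomials and extended by density. -/
theorem cyclicMap_mulMono [CompleteSpace H] [IsFiniteMeasure σ] (h : IsSpectralMeasure U ξ σ)
    (m : ℤ) (f : Lp ℂ 2 σ) : cyclicMap h (mulMono σ m f) = (U ^ m) (cyclicMap h f) := by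
  refine (denseRange_trigLp 2 (by norm_num) σ).induction (P := fun f =>
    cyclicMap h (mulMono σ m f) = (U ^ m) (cyclicMap h f)) ?_
    (isClosed_eq ((cyclicMap h).continuous.comp (mulMono σ m).continuous)
      ((U ^ m).continuous.comp (cyclicMap h).continuous)) f
  rintro _ ⟨p, rfl⟩
  induction p using Finsupp.induction_linear with
  | zero => simp
  | add p q hp hq => simp only [map_add, hp, hq]
  | single n a =>
    have hmul : mulMono σ m (trigLp 2 σ (Finsupp.single n a)) =
        trigLp 2 σ (Finsupp.single (m + n) a) := by
      refine Lp.ext ?_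
      filter_upwards [coeFn_mulMono m (trigLp 2 σ (Finsupp.single n a)),
        ContinuousMap.coeFn_toLp (p := 2) (𝕜 := ℂ) σ (trigPoly (Finsupp.single n a)),
        ContinuousMap.coeFn_toLp (p := 2) (𝕜 := ℂ) σ (trigPoly (Finsupp.single (m + n) a))]
        with z h1 h2 h3
      rw [h1]
      change _ * (ContinuousMap.toLp 2 σ ℂ (trigPoly (Finsupp.single n a)) : Lp ℂ 2 σ) z =
        (ContinuousMap.toLp 2 σ ℂ (trigPoly (Finsupp.single (m + n) a)) : Lp ℂ 2 σ) z
      rw [h2, h3, trigPoly_single, trigPoly_single]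
      simp only [ContinuousMap.smul_apply, smul_eq_mul, mono_add]
      ring
    rw [hmul, cyclicMap_trigLp, cyclicMap_trigLp, trigVec_single, trigVec_single,
      zpow_add_apply, map_smul]

/-- The restriction of a spectral measure to a measurable set is a spectral measure. -/
theorem IsSpectralMeasure.exists_restrict [CompleteSpace H] (h : IsSpectralMeasure U ξ σ)
    {S : Set Circle} (hS : MeasurableSet S) : ∃ η, IsSpectralMeasure U η (σ.restrict S) := by
  have := h.1
  set F : Lp ℂ 2 σ := indicatorConstLp 2 hS (measure_ne_top σ S) (1 : ℂ) with hF
  refine ⟨cyclicMap h F, inferInstance, fun m => ?_⟩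
  rw [← cyclicMap_mulMono, LinearIsometry.inner_map_map, hF,
    L2.inner_indicatorConstLp_eq_inner_setIntegral]
  have h1 : ∫ z in S, mulMono σ m F z ∂σ = ∫ z in S, mono m z ∂σ := by
    refine setIntegral_congr_ae hS ?_
    filter_upwards [coeFn_mulMono m F, indicatorConstLp_coeFn (p := 2) (hs := hS)
      (hμs := measure_ne_top σ S) (c := (1 : ℂ))] with z h1 h2 hz
    rw [h1, h2, Set.indicator_of_mem hz, mul_one]
  rw [← hF, h1]
  simp
  rfl

theorem IsSpectralMeasure.zpow_apply (h : IsSpectralMeasure U ξ σ) (l : ℤ) :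
    IsSpectralMeasure U ((U ^ l) ξ) σ := by
  refine ⟨h.1, fun m => ?_⟩
  rw [h.2, ← zpow_add_apply, inner_zpow_zpow, add_sub_cancel_right]

theorem norm_average_pow_le {w : ℂ} (hw : ‖w‖ = 1) (J : ℕ) :
    ‖∑ j ∈ Finset.range J, (1 / (J : ℂ)) * w ^ j‖ ≤ 1 := by
  refine (norm_sum_le _ _).trans ?_
  simp only [norm_mul, norm_pow, hw, one_pow, mul_one, Finset.sum_const, Finset.card_range,
    nsmul_eq_mul, norm_div, norm_one, Complex.norm_natCast, mul_one_div]
  exact div_self_le_one _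

theorem tendsto_average_pow {w : ℂ} (hw : ‖w‖ = 1) (hw1 : w ≠ 1) :
    Tendsto (fun J : ℕ => ∑ j ∈ Finset.range J, (1 / (J : ℂ)) * w ^ j) atTop (𝓝 0) := by
  have hne : w - 1 ≠ 0 := sub_ne_zero.2 hw1
  refine squeeze_zero_norm (a := fun J : ℕ => 2 / ‖w - 1‖ / J) (fun J => ?_)
    (tendsto_const_div_atTop_nhds_zero_nat _)
  rw [← Finset.mul_sum, geom_sum_eq hw1, norm_mul, norm_div, norm_div, norm_one,
    Complex.norm_natCast, one_div_mul_eq_div]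
  gcongr
  refine (norm_sub_le _ _).trans ?_
  rw [norm_pow, hw]
  norm_num

/-- Mean ergodic theorem for U ^ n: the squared norm is the σ-integral of |J⁻¹ ∑ z ^ (n j)|². The
integrand is at most 1 and tends to 0 off the n-th roots of unity, so dominated convergence applies.
-/
theorem IsSpectralMeasure.tendsto_average (h : IsSpectralMeasure U ξ σ) (n : ℕ)
    (hn : σ {z : Circle | z ^ n = 1} = 0) :
    Tendsto (fun J : ℕ => ∑ j ∈ Finset.range J, (1 / (J : ℂ)) • (U ^ ((j * n : ℕ) : ℤ)) ξ) atTop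
      (𝓝 0) := by
  have := h.1
  set p : ℕ → (ℤ →₀ ℂ) := fun J =>
    ∑ j ∈ Finset.range J, Finsupp.single ((j * n : ℕ) : ℤ) (1 / (J : ℂ)) with hp
  have hp1 : ∀ J, trigVec U ξ (p J) =
      ∑ j ∈ Finset.range J, (1 / (J : ℂ)) • (U ^ ((j * n : ℕ) : ℤ)) ξ := fun J => by
    simp only [hp, map_sum, trigVec_single]
  have hp2 : ∀ J z, trigPoly (p J) z =
      ∑ j ∈ Finset.range J, (1 / (J : ℂ)) * ((z ^ n : Circle) : ℂ) ^ j := fun J z => by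
    simp only [hp, map_sum, trigPoly_single, ContinuousMap.coe_sum, Finset.sum_apply,
      ContinuousMap.smul_apply, smul_eq_mul, mono_apply]
    refine Finset.sum_congr rfl fun j _ => ?_
    rw [zpow_natCast, mul_comm j, pow_mul, Circle.coe_pow _ j]
  have hlim : Tendsto (fun J => inner ℂ (trigVec U ξ (p J)) (trigVec U ξ (p J))) atTop
      (𝓝 (∫ _, (0 : ℂ) ∂σ)) := by
    simp only [h.inner_trigVec]
    refine tendsto_integral_of_dominated_convergence (fun _ => 1)
      (fun J => (star (trigPoly (p J)) * trigPoly (p J)).continuous.aestronglyMeasurable)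
      (integrable_const _) (fun J => ae_of_all _ fun z => ?_) ?_
    · have := norm_average_pow_le (Circle.norm_coe (z ^ n)) J
      rw [norm_mul, norm_star, hp2]
      exact mul_le_one₀ this (norm_nonneg _) this
    · have : ∀ᵐ z ∂σ, z ^ n ≠ 1 := by
        rw [ae_iff]
        simpa using hn
      filter_upwards [this] with z hz
      have h1 := tendsto_average_pow (Circle.norm_coe (z ^ n)) (by rwa [Ne, Circle.coe_eq_one])
      simp only [hp2]
      simpa using h1.star.mul h1
  simp only [integral_zero, inner_self_eq_norm_sq_to_K] at hlim
  have h2 := hlim.norm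
  simp only [norm_pow, norm_zero] at h2
  rw [tendsto_zero_iff_norm_tendsto_zero]
  have h3 := h2.sqrt
  simp only [Real.sqrt_zero] at h3
  refine h3.congr fun J => ?_
  rw [Real.sqrt_sq (norm_nonneg _), hp1]
  simp

/-- `x` is almost periodic with respect to `U` along multiples of arbitrarily good periods. -/
def IsUniformlyRecurrent (U : H ≃ₗᵢ[ℂ] H) (x : H) : Prop :=
  ∀ ε > 0, ∃ n : ℕ, 1 ≤ n ∧ ∀ j : ℕ, ‖(U ^ ((j * n : ℕ) : ℤ)) x - x‖ ≤ ε

/-- Since x is within ε of U ^ (j n) x for all j, the number ⟨ξ, x⟩ is within ε ‖ξ‖ of the inner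
product of x with the average of the U ^ (j n) ξ, which tends to 0. -/
theorem IsSpectralMeasure.inner_eq_zero (h : IsSpectralMeasure U ξ σ)
    (hσ : ∀ n : ℕ, 1 ≤ n → σ {z : Circle | z ^ n = 1} = 0) {x : H}
    (hx : IsUniformlyRecurrent U x) : inner ℂ ξ x = 0 := by
  have hbound : ∀ ε > 0, ‖inner ℂ ξ x‖ ≤ ε * ‖ξ‖ := by
    intro ε hε
    obtain ⟨n, hn, hj⟩ := hx ε hε
    have hlim := (Filter.Tendsto.inner (𝕜 := ℂ) (h.tendsto_average n (hσ n hn))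
      (tendsto_const_nhds (x := x))).norm.const_add (ε * ‖ξ‖)
    rw [inner_zero_left, norm_zero, add_zero] at hlim
    refine ge_of_tendsto hlim ?_
    filter_upwards [eventually_gt_atTop 0] with J hJ
    have hJ0 : (J : ℂ) ≠ 0 := by exact_mod_cast hJ.ne'
    have hJ1 : (J : ℝ) ≠ 0 := by exact_mod_cast hJ.ne'
    have heq : inner ℂ ξ x = (∑ j ∈ Finset.range J, (1 / (J : ℂ)) *
        inner ℂ ((U ^ ((j * n : ℕ) : ℤ)) ξ) ((U ^ ((j * n : ℕ) : ℤ)) x - x)) +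
        inner ℂ (∑ j ∈ Finset.range J, (1 / (J : ℂ)) • (U ^ ((j * n : ℕ) : ℤ)) ξ) x := by
      rw [sum_inner, ← Finset.sum_add_distrib]
      have : ∀ j ∈ Finset.range J, (1 / (J : ℂ)) *
          inner ℂ ((U ^ ((j * n : ℕ) : ℤ)) ξ) ((U ^ ((j * n : ℕ) : ℤ)) x - x) +
          inner ℂ ((1 / (J : ℂ)) • (U ^ ((j * n : ℕ) : ℤ)) ξ) x = (1 / (J : ℂ)) * inner ℂ ξ x := by
        intro j _
        rw [inner_sub_right, LinearIsometryEquiv.inner_map_map, inner_smul_left]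
        simp only [map_div₀, map_one, map_natCast]
        ring
      rw [Finset.sum_congr rfl this, Finset.sum_const, Finset.card_range, nsmul_eq_mul]
      field_simp
    conv_lhs => rw [heq]
    refine (norm_add_le _ _).trans (add_le_add_left ?_ _)
    calc _ ≤ ∑ j ∈ Finset.range J, 1 / (J : ℝ) * (ε * ‖ξ‖) := by
          refine norm_sum_le_of_le _ fun j _ => ?_
          rw [norm_mul, norm_div, norm_one, Complex.norm_natCast]
          gcongr
          refine (norm_inner_le_norm _ _).trans ?_
          rw [LinearIsometryEquiv.norm_map, mul_comm]
          gcongr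
          exact hj j
      _ = ε * ‖ξ‖ := by
          rw [Finset.sum_const, Finset.card_range, nsmul_eq_mul]
          field_simp
  refine norm_eq_zero.1 (le_antisymm ?_ (norm_nonneg _))
  have : Tendsto (fun ε : ℝ => ε * ‖ξ‖) (𝓝[>] 0) (𝓝 (0 * ‖ξ‖)) :=
    (tendsto_nhdsWithin_of_tendsto_nhds tendsto_id).mul_const _
  rw [zero_mul] at this
  refine ge_of_tendsto this ?_
  filter_upwards [self_mem_nhdsWithin] with ε hε using hbound ε hε

end Spectral

/-! ### Weak limits -/

/-- The set of points at which a sequence of functions with a common Lipschitz constant tends to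
zero is closed. -/
theorem tendsto_zero_of_mem_closure {X : Type*} [PseudoMetricSpace X] {F : ℕ → X → ℂ} {K : ℝ}
    (hF : ∀ i x x', ‖F i x - F i x'‖ ≤ K * dist x x') {s : Set X}
    (hs : ∀ x ∈ s, Tendsto (fun i => F i x) atTop (𝓝 0)) {x : X} (hx : x ∈ closure s) :
    Tendsto (fun i => F i x) atTop (𝓝 0) := by
  rw [Metric.tendsto_atTop]
  intro ε hε
  -- No sign of K is assumed; |K| + 1 serves as a positive constant.
  have hK : 0 < |K| + 1 := by positivity
  obtain ⟨x', hx', hd⟩ := Metric.mem_closure_iff.1 hx (ε / 2 / (|K| + 1)) (by positivity)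
  obtain ⟨N, hN⟩ := Metric.tendsto_atTop.1 (hs x' hx') (ε / 2) (by positivity)
  refine ⟨N, fun i hi => ?_⟩
  have h1 := hN i hi
  rw [dist_zero_right] at h1 ⊢
  have h2 : K * dist x x' ≤ ε / 2 := by
    rw [lt_div_iff₀ hK] at hd
    nlinarith [le_abs_self K, dist_nonneg (x := x) (y := x')]
  calc ‖F i x‖ = ‖(F i x - F i x') + F i x'‖ := by rw [sub_add_cancel]
    _ ≤ ‖F i x - F i x'‖ + ‖F i x'‖ := norm_add_le _ _
    _ < ε / 2 + ε / 2 := add_lt_add_of_le_of_lt ((hF i x x').trans h2) h1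
    _ = ε := add_halves ε

/-- The functions `φ i` converge to the constant `a`, weakly in the dual of `L¹(ν)`. -/
def HasWeakLimit {X : Type*} [MeasurableSpace X] (φ : ℕ → X → ℂ) (ν : Measure X) (a : ℂ) : Prop :=
  ∀ f : X → ℂ, Integrable f ν → Tendsto (fun i => ∫ z, φ i z * f z ∂ν) atTop (𝓝 (a * ∫ z, f z ∂ν))

/-- Testing against all of L¹ is what makes this work: the density dν/dτ is absorbed into the test
function. -/
theorem HasWeakLimit.of_absolutelyContinuous {X : Type*} [MeasurableSpace X] {φ : ℕ → X → ℂ}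
    {ν τ : Measure X} [IsFiniteMeasure ν] [IsFiniteMeasure τ] {a : ℂ} (h : HasWeakLimit φ τ a)
    (hν : ν ≪ τ) : HasWeakLimit φ ν a := by
  intro f hf
  have h1 := h _ ((integrable_rnDeriv_smul_iff hν).2 hf)
  rw [integral_rnDeriv_smul hν] at h1
  refine h1.congr fun i => ?_
  rw [← integral_rnDeriv_smul hν]
  congr with z
  simp only [Complex.real_smul]
  ring

/-- The part of α that is absolutely continuous with respect to β inherits both weak limits. Testing
against 1 gives a α(s) = c α(s), so this part vanishes. -/
theorem mutuallySingular_of_hasWeakLimit {X : Type*} [MeasurableSpace X] {φ : ℕ → X → ℂ}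
    {α β : Measure X} [IsFiniteMeasure α] [IsFiniteMeasure β] {a c : ℂ} (hα : HasWeakLimit φ α a)
    (hβ : HasWeakLimit φ β c) (hac : a ≠ c) : α.MutuallySingular β := by
  obtain ⟨s, hs, hs1, hs2⟩ := Measure.mutuallySingular_singularPart α β
  have habs : α.restrict s ≪ β := by
    have h1 : α.restrict s = (β.withDensity (α.rnDeriv β)).restrict s := by
      conv_lhs => rw [← Measure.singularPart_add_rnDeriv α β, Measure.restrict_add,
        Measure.restrict_eq_zero.2 hs1, zero_add]
    rw [h1]
    exact Measure.restrict_le_self.absolutelyContinuous.trans (withDensity_absolutelyContinuous _ _)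
  have h1 := hα.of_absolutelyContinuous
    (Measure.restrict_le_self (s := s)).absolutelyContinuous _ (integrable_const 1)
  have h2 := hβ.of_absolutelyContinuous habs _ (integrable_const 1)
  have h3 := tendsto_nhds_unique h1 h2
  refine ⟨s, hs, ?_, hs2⟩
  simp only [integral_const, Complex.real_smul, mul_one] at h3
  by_contra h0
  have h4 : ((α.restrict s).real Set.univ : ℂ) ≠ 0 := by
    rw [Complex.ofReal_ne_zero, Measure.real, Measure.restrict_apply_univ]
    exact ENNReal.toReal_ne_zero.2 ⟨h0, measure_ne_top _ _⟩
  exact hac (mul_right_cancel₀ h4 h3)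

theorem HasWeakLimit.map {X Y : Type*} [MeasurableSpace X] [MeasurableSpace Y] {φ : ℕ → Y → ℂ}
    (hφ : ∀ i, Measurable (φ i)) {g : X → Y} (hg : Measurable g) {ν : Measure X} {a : ℂ}
    (h : HasWeakLimit (fun i => φ i ∘ g) ν a) : HasWeakLimit φ (ν.map g) a := by
  intro f hf
  have h1 := h _ (hf.comp_measurable hg)
  rw [integral_map hg.aemeasurable hf.aestronglyMeasurable]
  refine h1.congr fun i => ?_
  exact (integral_map (f := fun z => φ i z * f z) hg.aemeasurable
    ((hφ i).aestronglyMeasurable.mul hf.aestronglyMeasurable)).symm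

theorem norm_integral_mono_mul_sub_le {τ : Measure Circle} [IsFiniteMeasure τ] (m : ℤ)
    (f g : Lp ℂ 1 τ) :
    ‖∫ z, mono m z * f z ∂τ - ∫ z, mono m z * g z ∂τ‖ ≤ dist f g := by
  have hint : ∀ f : Lp ℂ 1 τ, Integrable (fun z => mono m z * f z) τ := fun f =>
    (L1.integrable_coeFn f).bdd_mul (c := 1) (mono m).continuous.aestronglyMeasurable
      (ae_of_all _ fun z => (norm_mono m z).le)
  rw [← integral_sub (hint f) (hint g), dist_eq_norm, L1.norm_eq_integral_norm]
  refine (norm_integral_le_integral_norm _).trans (le_of_eq (integral_congr_ae ?_))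
  filter_upwards [Lp.coeFn_sub f g] with z hz
  rw [hz, ← mul_sub, norm_mul, norm_mono, one_mul, Pi.sub_apply]

/-- Weak limits of characters can be tested on characters. -/
theorem hasWeakLimit_mono {τ : Measure Circle} [IsFiniteMeasure τ] {k : ℕ → ℤ} {a : ℂ}
    (h : ∀ l : ℤ, Tendsto (fun i => ∫ z, mono (k i + l) z ∂τ) atTop (𝓝 (a * ∫ z, mono l z ∂τ))) :
    HasWeakLimit (fun i => mono (k i)) τ a := by
  have h0 : ∀ z, mono 0 z = 1 := fun z => by simp [mono_apply]
  have key : ∀ f : Lp ℂ 1 τ, Tendsto (fun i => ∫ z, mono (k i) z * f z ∂τ -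
      a * ∫ z, mono 0 z * f z ∂τ) atTop (𝓝 0) := by
    intro f
    refine tendsto_zero_of_mem_closure
      (F := fun i (f : Lp ℂ 1 τ) => ∫ z, mono (k i) z * f z ∂τ - a * ∫ z, mono 0 z * f z ∂τ)
      (K := 1 + ‖a‖) (fun i f g => ?_) ?_ (denseRange_trigLp 1 (by norm_num) τ f)
    · rw [sub_sub_sub_comm, ← mul_sub, add_mul, one_mul]
      refine (norm_sub_le _ _).trans (add_le_add (norm_integral_mono_mul_sub_le _ f g) ?_)
      rw [norm_mul]
      gcongr
      exact norm_integral_mono_mul_sub_le _ f g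
    · rintro _ ⟨p, rfl⟩
      have hint : ∀ m p, ∫ z, mono m z * (trigLp 1 τ p) z ∂τ = ∫ z, (mono m * trigPoly p) z ∂τ :=
        fun m p => by
          refine integral_congr_ae ?_
          filter_upwards [ContinuousMap.coeFn_toLp (p := 1) (𝕜 := ℂ) τ (trigPoly p)] with z hz
          change _ * (ContinuousMap.toLp 1 τ ℂ (trigPoly p) : Lp ℂ 1 τ) z = _
          rw [hz]
          rfl
      simp only [hint]
      induction p using Finsupp.induction_linear with
      | zero => simp
      | add p q hp hq =>
        have := hp.add hq
        rw [add_zero] at this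
        refine this.congr fun i => ?_
        have hadd : ∀ m, ∫ z, (mono m * trigPoly (p + q)) z ∂τ =
            ∫ z, (mono m * trigPoly p) z ∂τ + ∫ z, (mono m * trigPoly q) z ∂τ := fun m => by
          rw [← integral_add (integrable_continuousMap _) (integrable_continuousMap _), map_add,
            mul_add]
          rfl
        rw [hadd, hadd]
        ring
      | single l c =>
        have hs : ∀ m, ∫ z, (mono m * trigPoly (Finsupp.single l c)) z ∂τ =
            c * ∫ z, mono (m + l) z ∂τ := fun m => by
          rw [trigPoly_single, ← integral_const_mul]
          congr with z
          simp only [ContinuousMap.mul_apply, ContinuousMap.smul_apply, smul_eq_mul, mono_add]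
          ring
        simp only [hs, zero_add]
        have := ((tendsto_sub_nhds_zero_iff.2 (h l)).const_mul c)
        rw [mul_zero] at this
        refine this.congr fun i => ?_
        ring
  intro f hf
  rw [← tendsto_sub_nhds_zero_iff]
  refine (key hf.toL1).congr fun i => ?_
  congr 1
  · refine integral_congr_ae ?_
    filter_upwards [hf.coeFn_toL1] with z hz
    rw [hz]
  · congr 1
    refine integral_congr_ae ?_
    filter_upwards [hf.coeFn_toL1] with z hz
    rw [hz, h0, one_mul]

/-! ### Weak limits on the spectral measures of a unitary operator -/

section Spectral

variable {H : Type*} [NormedAddCommGroup H] [InnerProductSpace ℂ H] {U : H ≃ₗᵢ[ℂ] H}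

/-- The component of η orthogonal to the closed span of O is also orthogonal to E, hence to a dense
subspace, and so it is zero. -/
theorem mem_closure_span_of_forall_inner_eq_zero [CompleteSpace H] {E O : Set H}
    (hdense : (Submodule.span ℂ (E ∪ O)).topologicalClosure = ⊤)
    (hEO : ∀ e ∈ E, ∀ x ∈ O, inner ℂ e x = 0) {η : H} (hη : ∀ e ∈ E, inner ℂ η e = 0) :
    η ∈ closure (Submodule.span ℂ O : Set H) := by
  set V := (Submodule.span ℂ O).topologicalClosure with hV
  have : CompleteSpace V := (Submodule.isClosed_topologicalClosure _).completeSpace_coe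
  change η ∈ V
  rw [← Submodule.orthogonal_orthogonal V, Submodule.mem_orthogonal]
  intro w hw
  have hwO : ∀ x ∈ O, inner ℂ w x = 0 := fun x hx => by
    have := Submodule.mem_orthogonal V w |>.1 hw x
      (Submodule.le_topologicalClosure _ (Submodule.subset_span hx))
    exact inner_eq_zero_symm.1 this
  obtain ⟨u, hu, v, hv, rfl⟩ := V.exists_add_mem_mem_orthogonal η
  have hv0 : v = 0 := by
    have hle : Submodule.span ℂ (E ∪ O) ≤ (Submodule.span ℂ {v})ᗮ := by
      rw [Submodule.span_le]
      rintro x (hx | hx)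
      · rw [SetLike.mem_coe, Submodule.mem_orthogonal_singleton_iff_inner_right]
        have h1 := hη x hx
        have h2 : inner ℂ u x = 0 := by
          have hcl : V ≤ (Submodule.span ℂ {x})ᗮ := by
            refine Submodule.topologicalClosure_minimal _ (Submodule.span_le.2 fun o ho => ?_)
              (Submodule.isClosed_orthogonal _)
            rw [SetLike.mem_coe, Submodule.mem_orthogonal_singleton_iff_inner_right]
            exact hEO x hx o ho
          exact inner_eq_zero_symm.1
            (Submodule.mem_orthogonal_singleton_iff_inner_right.1 (hcl hu))
        rwa [inner_add_left, h2, zero_add] at h1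
      · rw [SetLike.mem_coe, Submodule.mem_orthogonal_singleton_iff_inner_right]
        exact inner_eq_zero_symm.1 (Submodule.mem_orthogonal V v |>.1 hv x
          (Submodule.le_topologicalClosure _ (Submodule.subset_span hx)))
    have htop : (⊤ : Submodule ℂ H) ≤ (Submodule.span ℂ {v})ᗮ :=
      hdense ▸ Submodule.topologicalClosure_minimal _ hle (Submodule.isClosed_orthogonal _)
    have := Submodule.mem_orthogonal_singleton_iff_inner_right.1
      (htop (Submodule.mem_top (x := v)))
    exact inner_self_eq_zero.1 this
  rw [hv0, add_zero]
  exact inner_eq_zero_symm.1 (Submodule.mem_orthogonal V w |>.1 hw u hu)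

theorem tendsto_inner_of_mem_closure_span {O : Set H} {k : ℕ → ℤ} {a : ℂ}
    (hO : ∀ x ∈ O, ∀ x' ∈ O,
      Tendsto (fun i => inner ℂ x ((U ^ k i) x')) atTop (𝓝 (a * inner ℂ x x')))
    {x x' : H} (hx : x ∈ closure (Submodule.span ℂ O : Set H))
    (hx' : x' ∈ closure (Submodule.span ℂ O : Set H)) :
    Tendsto (fun i => inner ℂ x ((U ^ k i) x')) atTop (𝓝 (a * inner ℂ x x')) := by
  have h1 : ∀ x ∈ O, ∀ x' ∈ closure (Submodule.span ℂ O : Set H),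
      Tendsto (fun i => inner ℂ x ((U ^ k i) x') - a * inner ℂ x x') atTop (𝓝 0) := by
    intro x hx x' hx'
    refine tendsto_zero_of_mem_closure
      (F := fun i x' => inner ℂ x ((U ^ k i) x') - a * inner ℂ x x')
      (K := ‖x‖ + ‖a‖ * ‖x‖) (fun i u v => ?_) (fun u hu => ?_) hx'
    · rw [sub_sub_sub_comm, ← mul_sub, ← inner_sub_right, ← inner_sub_right, ← map_sub, add_mul,
        dist_eq_norm]
      refine (norm_sub_le _ _).trans (add_le_add ?_ ?_)
      · refine (norm_inner_le_norm _ _).trans ?_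
        rw [LinearIsometryEquiv.norm_map]
      · rw [norm_mul, mul_assoc]
        gcongr
        exact norm_inner_le_norm _ _
    · induction hu using Submodule.span_induction with
      | mem u hu => exact tendsto_sub_nhds_zero_iff.2 (hO x hx u hu)
      | zero => simp
      | add u v _ _ hu hv =>
        have := hu.add hv
        rw [add_zero] at this
        refine this.congr fun i => ?_
        rw [map_add, inner_add_right, inner_add_right]
        ring
      | smul c u _ hu =>
        have := hu.const_mul c
        rw [mul_zero] at this
        refine this.congr fun i => ?_
        rw [map_smul, inner_smul_right, inner_smul_right]
        ring
  rw [← tendsto_sub_nhds_zero_iff]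
  refine tendsto_zero_of_mem_closure
    (F := fun i x => inner ℂ x ((U ^ k i) x') - a * inner ℂ x x')
    (K := ‖x'‖ + ‖a‖ * ‖x'‖) (fun i u v => ?_) (fun u hu => ?_) hx
  · rw [sub_sub_sub_comm, ← mul_sub, ← inner_sub_left, ← inner_sub_left, add_mul,
      dist_eq_norm]
    refine (norm_sub_le _ _).trans (add_le_add ?_ ?_)
    · refine (norm_inner_le_norm _ _).trans ?_
      rw [LinearIsometryEquiv.norm_map, mul_comm]
    · rw [norm_mul, mul_assoc, mul_comm ‖x'‖]
      gcongr
      exact norm_inner_le_norm _ _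
  · induction hu using Submodule.span_induction with
    | mem u hu => exact h1 u hu x' hx'
    | zero => simp
    | add u v _ _ hu hv =>
      have := hu.add hv
      rw [add_zero] at this
      refine this.congr fun i => ?_
      rw [inner_add_left, inner_add_left]
      ring
    | smul c u _ hu =>
      have := hu.const_mul (starRingEnd ℂ c)
      rw [mul_zero] at this
      refine this.congr fun i => ?_
      rw [inner_smul_left, inner_smul_left]
      ring

/-- The roots of unity. -/
def rootsOfUnityCircle : Set Circle := {z | ∃ n : ℕ, 1 ≤ n ∧ z ^ n = 1}

theorem countable_rootsOfUnityCircle : rootsOfUnityCircle.Countable := by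
  have : rootsOfUnityCircle ⊆ ⋃ n : ℕ, ⋃ _ : 1 ≤ n, {z : Circle | z ^ n = 1} := by
    rintro z ⟨n, hn, hz⟩
    exact Set.mem_iUnion₂.2 ⟨n, hn, hz⟩
  refine Set.Countable.mono this (Set.countable_iUnion fun n => Set.countable_iUnion fun hn => ?_)
  have hfin : (((Polynomial.nthRoots n (1 : ℂ)).toFinset : Finset ℂ) : Set ℂ).Finite :=
    Finset.finite_toSet _
  refine ((hfin.preimage (f := ((↑) : Circle → ℂ)) Circle.coe_injective.injOn).subset
    fun z (hz : z ^ n = 1) => ?_).countable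
  rw [Set.mem_preimage, Finset.mem_coe, Multiset.mem_toFinset, Polynomial.mem_nthRoots hn]
  exact congrArg ((↑) : Circle → ℂ) hz

/-- Off the roots of unity σ is the spectral measure of a vector η orthogonal to E. All U ^ l η then
lie in the closed span of O, where U ^ (k i) tends weakly to a; read through the spectral measure,
this is the claim tested on characters. -/
theorem hasWeakLimit_of_isSpectralMeasure [CompleteSpace H] {E O : Set H}
    (hdense : (Submodule.span ℂ (E ∪ O)).topologicalClosure = ⊤)
    (hEO : ∀ e ∈ E, ∀ x ∈ O, inner ℂ e x = 0) (hE : ∀ e ∈ E, IsUniformlyRecurrent U e)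
    {k : ℕ → ℤ} {a : ℂ}
    (hO : ∀ x ∈ O, ∀ x' ∈ O,
      Tendsto (fun i => inner ℂ x ((U ^ k i) x')) atTop (𝓝 (a * inner ℂ x x')))
    {ξ : H} {σ : Measure Circle} (hσ : IsSpectralMeasure U ξ σ) :
    HasWeakLimit (fun i => mono (k i)) (σ.restrict rootsOfUnityCircleᶜ) a := by
  have := hσ.1
  obtain ⟨η, hη⟩ := hσ.exists_restrict countable_rootsOfUnityCircle.measurableSet.compl
  have hnull : ∀ n : ℕ, 1 ≤ n →
      σ.restrict rootsOfUnityCircleᶜ {z : Circle | z ^ n = 1} = 0 := by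
    intro n hn
    refine measure_mono_null (fun z hz => ?_) (Measure.restrict_apply_eq_zero'
      countable_rootsOfUnityCircle.measurableSet.compl |>.2
        (by rw [Set.inter_compl_self, measure_empty]))
    exact ⟨n, hn, hz⟩
  have hmem : ∀ l : ℤ, (U ^ l) η ∈ closure (Submodule.span ℂ O : Set H) := fun l =>
    mem_closure_span_of_forall_inner_eq_zero hdense hEO fun e he =>
      (hη.zpow_apply l).inner_eq_zero hnull (hE e he)
  refine hasWeakLimit_mono fun l => ?_
  have h0 := hmem 0
  rw [zpow_zero] at h0
  have := tendsto_inner_of_mem_closure_span hO h0 (hmem l)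
  change Tendsto (fun i => inner ℂ η ((U ^ k i) ((U ^ l) η))) atTop _ at this
  simp only [← zpow_add_apply, ← hη.2] at this
  change Tendsto _ _ (𝓝 (a * inner ℂ η ((U ^ l) η))) at this
  rwa [← hη.2] at this

end Spectral

/-! ### The characters as vectors -/

/-- The character `chi l` as a continuous complex function. -/
def chiC (l : Multiset ℤ) : C(ℤ → Bool, ℂ) :=
  ⟨fun u => (chi l u : ℂ), Complex.continuous_ofReal.comp (continuous_chi l)⟩

theorem chiC_apply (l : Multiset ℤ) (u : ℤ → Bool) : chiC l u = (chi l u : ℂ) := rfl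

theorem chiC_add (l l' : Multiset ℤ) : chiC (l + l') = chiC l * chiC l' := by
  ext u
  simp [chiC_apply, chi_add]

/-- The star subalgebra spanned by the characters. -/
def chiSubalgebra : StarSubalgebra ℂ C(ℤ → Bool, ℂ) where
  carrier := Submodule.span ℂ (Set.range chiC)
  add_mem' := Submodule.add_mem _
  zero_mem' := Submodule.zero_mem _
  algebraMap_mem' a := by
    have : algebraMap ℂ C(ℤ → Bool, ℂ) a = a • chiC 0 := by
      ext u
      simp [chiC_apply, chi]
    rw [this]
    exact Submodule.smul_mem _ _ (Submodule.subset_span ⟨0, rfl⟩)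
  mul_mem' := by
    intro f g hf hg
    have h := Submodule.mul_mem_mul hf hg
    rw [Submodule.span_mul_span] at h
    refine Submodule.span_mono ?_ h
    rintro _ ⟨_, ⟨l, rfl⟩, _, ⟨l', rfl⟩, rfl⟩
    exact ⟨l + l', chiC_add l l'⟩
  star_mem' := by
    intro f hf
    change star f ∈ Submodule.span ℂ (Set.range chiC)
    induction hf using Submodule.span_induction with
    | mem f hf =>
      obtain ⟨l, rfl⟩ := hf
      have : star (chiC l) = chiC l := by
        ext u
        simp [chiC_apply]
      rw [this]
      exact Submodule.subset_span ⟨l, rfl⟩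
    | zero => simp
    | add f g _ _ hf hg => rw [star_add]; exact Submodule.add_mem _ hf hg
    | smul c f _ hf => rw [star_smul]; exact Submodule.smul_mem _ _ hf

theorem topologicalClosure_span_chiC :
    (Submodule.span ℂ (Set.range chiC)).topologicalClosure = ⊤ := by
  have h := ContinuousMap.starSubalgebra_topologicalClosure_eq_top_of_separatesPoints
    chiSubalgebra (fun u v huv => by
      obtain ⟨i, hi⟩ := Function.ne_iff.1 huv
      refine ⟨_, ⟨chiC {i}, Submodule.subset_span ⟨_, rfl⟩, rfl⟩, ?_⟩
      simp only [chiC_apply, chi, Multiset.map_singleton, Multiset.prod_singleton, ne_eq,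
        Complex.ofReal_inj]
      revert hi
      cases u i <;> cases v i <;> norm_num [sgn])
  rw [Submodule.eq_top_iff']
  intro f
  have hf : f ∈ chiSubalgebra.topologicalClosure := h ▸ StarSubalgebra.mem_top
  exact hf

section Koopman

variable {μ : Measure (ℤ → Bool)} [IsFiniteMeasure μ]

/-- The character `chi l` as an element of `L²(μ)`. -/
def chiVec (μ : Measure (ℤ → Bool)) [IsFiniteMeasure μ] (l : Multiset ℤ) : Lp ℂ 2 μ :=
  ContinuousMap.toLp 2 μ ℂ (chiC l)

theorem coeFn_chiVec (l : Multiset ℤ) : chiVec μ l =ᵐ[μ] chiC l :=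
  ContinuousMap.coeFn_toLp μ (chiC l)

theorem inner_chiVec (l l' : Multiset ℤ) :
    inner ℂ (chiVec μ l) (chiVec μ l') = ((∫ u, chi (l + l') u ∂μ : ℝ) : ℂ) := by
  rw [chiVec, chiVec, ContinuousMap.inner_toLp, ← integral_complex_ofReal]
  congr with u
  simp [chiC_apply, chi_add, mul_comm]

theorem koopman_chiVec (hT : MeasurePreserving shift μ μ) (l : Multiset ℤ) :
    koopman shift hT (chiVec μ l) = chiVec μ (l.map (· + 1)) := by
  refine Lp.ext ?_
  change Lp.compMeasurePreserving shift hT (chiVec μ l) =ᵐ[μ] _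
  filter_upwards [Lp.coeFn_compMeasurePreserving (chiVec μ l) hT,
    hT.quasiMeasurePreserving.ae_eq_comp (coeFn_chiVec (μ := μ) l),
    coeFn_chiVec (μ := μ) (l.map (· + 1))] with u h1 h2 h3
  rw [h1, h2, h3, Function.comp_apply, chiC_apply, chiC_apply]
  have := chi_shift_iterate l 1 u
  rw [Function.iterate_one, Nat.cast_one] at this
  rw [this]

theorem koopman_zpow_chiVec (hT : MeasurePreserving shift μ μ) (n : ℕ) (l : Multiset ℤ) :
    (koopman shift hT ^ (n : ℤ)) (chiVec μ l) = chiVec μ (l.map (· + (n : ℤ))) := by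
  induction n with
  | zero => simp
  | succ n ih =>
    rw [Nat.cast_succ, add_comm, zpow_add_apply, ih, zpow_one, koopman_chiVec, Multiset.map_map]
    congr 2
    ext i
    simp only [Function.comp_apply]
    ring

theorem topologicalClosure_span_chiVec :
    (Submodule.span ℂ (Set.range (chiVec μ))).topologicalClosure = ⊤ := by
  have h := (ContinuousMap.toLp_denseRange ℂ μ ℂ
    (by norm_num : (2 : ℝ≥0∞) ≠ ∞)).topologicalClosure_map_submodule topologicalClosure_span_chiC
  rw [Submodule.map_span, ← Set.range_comp] at h
  exact h

end Koopman

/-! ### The continuous spectrum of the Morse system -/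

section MorseSequence

variable {b : ℕ → List Bool} {y : ℕ → Bool}

theorem IsMorseSequence.isUniformlyRecurrent_chiVec (hy : IsMorseSequence b y)
    {μ : Measure (ℤ → Bool)} (hμ : IsInvariantMeasureOn y μ) [IsFiniteMeasure μ] {l : Multiset ℤ}
    (hl : Even (Multiset.card l)) :
    IsUniformlyRecurrent (koopman shift hμ.measurePreserving) (chiVec μ l) := by
  intro ε hε
  have := hμ.isProbabilityMeasure
  obtain ⟨D, hD⟩ := exists_radius l
  -- For unit vectors the squared distance is 2 minus twice the real inner product, so it is at most
  -- 8 D / L, where L ≥ k.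
  obtain ⟨k, hk⟩ := exists_nat_gt (8 * D / ε ^ 2)
  have hL : (k : ℝ) ≤ (blockProd b k).length := by
    exact_mod_cast (Nat.lt_two_pow_self.le.trans
      (Nat.pow_le_pow_right two_pos (Nat.le_succ k))).trans (hy.pow_two_le_length k)
  have hL0 : (0 : ℝ) < (blockProd b k).length := by exact_mod_cast hy.length_pos k
  refine ⟨(blockProd b k).length, hy.length_pos k, fun j => ?_⟩
  have h1 := hy.one_sub_le_integral_chi hμ hl hD k j
  have hself : ∀ l, ‖chiVec μ l‖ ^ 2 = 1 := fun l => by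
    have := inner_self_eq_norm_sq_to_K (𝕜 := ℂ) (chiVec μ l)
    rw [inner_chiVec] at this
    simp only [chi_add, chi_mul_self, integral_const, probReal_univ, smul_eq_mul, mul_one] at this
    have h2 : ((‖chiVec μ l‖ ^ 2 : ℝ) : ℂ) = 1 := by
      rw [Complex.ofReal_pow]
      simpa using this.symm
    exact_mod_cast h2
  refine le_of_sq_le_sq ?_ hε.le
  rw [koopman_zpow_chiVec, @norm_sub_sq ℂ, hself, hself, ← inner_re_symm, inner_chiVec]
  have h2 : 4 * D / ((blockProd b k).length : ℝ) ≤ ε ^ 2 / 2 := by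
    rw [div_le_iff₀ hL0]
    rw [div_lt_iff₀ (by positivity)] at hk
    nlinarith [sq_nonneg ε]
  change 1 - 2 * (∫ u, chi _ u ∂μ) + 1 ≤ _
  linarith

theorem continuousPart_absolutelyContinuous {ρ σ : Measure Circle} (h : ρ ≪ σ) {C : Set Circle}
    (hC : C.Countable) : continuousPart ρ ≪ σ.restrict Cᶜ := by
  have hatom : ∀ z, continuousPart ρ {z} = 0 := fun z => by
    rw [continuousPart, Measure.restrict_apply (measurableSet_singleton z)]
    by_cases hz : ρ {z} = 0
    · exact measure_mono_null Set.inter_subset_left hz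
    · rw [Set.singleton_inter_eq_empty.2 (by simpa using hz), measure_empty]
  have hC0 : continuousPart ρ C = 0 := by
    rw [← Set.biUnion_of_singleton C]
    exact (measure_biUnion_null_iff hC).2 fun z _ => hatom z
  intro A hA
  rw [Measure.restrict_apply' hC.measurableSet.compl] at hA
  have h1 : continuousPart ρ (A ∩ Cᶜ) = 0 :=
    (Measure.restrict_le_self.absolutelyContinuous.trans h) hA
  refine measure_mono_null (fun z hz => ?_) (measure_union_null h1 hC0)
  by_cases hzC : z ∈ C
  · exact Or.inr hzC
  · exact Or.inl ⟨hz, hzC⟩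

/-- The characters `z ↦ z ^ (q N_i)` converge weakly to the autocorrelation of the Thue-Morse
sequence at `q` on the continuous part of the maximal spectral type. -/
theorem IsMorseSequence.exists_hasWeakLimit (hy : IsMorseSequence b y) (hb : IsThueMorseType b)
    {μ : Measure (ℤ → Bool)} (hμ : IsInvariantMeasureOn y μ) {ρ : Measure Circle}
    (hρ : IsMaximalSpectralType (koopman shift hμ.measurePreserving) ρ) :
    ∃ N : ℕ → ℕ, ∀ q : ℕ, HasWeakLimit (fun i => mono ((q * N i : ℕ) : ℤ)) (continuousPart ρ)
      (autocorr q) := by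
  have := hμ.isProbabilityMeasure
  have := hρ.isFiniteMeasure
  obtain ⟨N, hN⟩ := hy.exists_tendsto_integral_chi hb hμ
  obtain ⟨ξ, σ, hσ, hρσ⟩ := hρ.attained
  have := hσ.1
  refine ⟨N, fun q => ?_⟩
  have : IsFiniteMeasure (continuousPart ρ) := by unfold continuousPart; infer_instance
  refine HasWeakLimit.of_absolutelyContinuous ?_
    (continuousPart_absolutelyContinuous hρσ countable_rootsOfUnityCircle)
  refine hasWeakLimit_of_isSpectralMeasure
    (E := chiVec μ '' {l | Even (Multiset.card l)}) (O := chiVec μ '' {l | Odd (Multiset.card l)})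
    ?_ ?_ ?_ ?_ hσ
  · rw [← Set.image_union, show {l : Multiset ℤ | Even (Multiset.card l)} ∪
      {l | Odd (Multiset.card l)} = Set.univ from Set.eq_univ_of_forall fun l =>
        Nat.even_or_odd _, Set.image_univ]
    exact topologicalClosure_span_chiVec
  · rintro _ ⟨l, hl, rfl⟩ _ ⟨l', hl', rfl⟩
    rw [inner_chiVec, hy.integral_chi_of_odd hb hμ (by
      rw [Multiset.card_add]; exact Even.add_odd hl hl'), Complex.ofReal_zero]
  · rintro _ ⟨l, hl, rfl⟩
    exact hy.isUniformlyRecurrent_chiVec hμ hl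
  · rintro _ ⟨l, hl, rfl⟩ _ ⟨l', hl', rfl⟩
    simp only [koopman_zpow_chiVec, inner_chiVec]
    rw [← Complex.ofReal_mul]
    exact (Complex.continuous_ofReal.tendsto _).comp (hN q l l' hl hl')

end MorseSequence

end Morse

end

theorem mainTheorem4 (b : ℕ → List Bool) (y : ℕ → Bool)
    (hy : Morse.IsMorseSequence b y) (hb : Morse.IsThueMorseType b)
    (μ : Measure (ℤ → Bool)) (hμ : Morse.IsInvariantMeasureOn y μ)
    (ρ : Measure Circle)
    (hρ : Morse.IsMaximalSpectralType (Morse.koopman Morse.shift hμ.measurePreserving) ρ)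
    (r s : ℕ) (hr : Odd r) (hs : Odd s) (hrs : r ≠ s) :
    (Morse.powImage (Morse.continuousPart ρ) r).MutuallySingular
      (Morse.powImage (Morse.continuousPart ρ) s) := by
  wlog hsr : s < r generalizing r s
  · exact (this s r hs hr hrs.symm (by omega)).symm
  obtain ⟨N, hN⟩ := hy.exists_hasWeakLimit hb hμ hρ
  obtain ⟨m, hm⟩ := Morse.exists_autocorr_mul_ne hr hs hsr
  have := hρ.isFiniteMeasure
  have : IsFiniteMeasure (Morse.continuousPart ρ) := by
    unfold Morse.continuousPart; infer_instance
  have : ∀ t, IsFiniteMeasure (Morse.powImage (Morse.continuousPart ρ) t) := fun t => by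
    unfold Morse.powImage; infer_instance
  -- Pulling z ^ (m N_i) back along z ↦ z ^ t gives z ^ (t m N_i), so the same functions see the
  -- autocorrelation at t m on the t-th image.
  have key : ∀ t : ℕ, Morse.HasWeakLimit (fun i => Morse.mono ((m * N i : ℕ) : ℤ))
      (Morse.powImage (Morse.continuousPart ρ) t) (Morse.autocorr (t * m)) := by
    intro t
    refine Morse.HasWeakLimit.map (fun i => (Morse.mono _).continuous.measurable)
      (continuous_pow t).measurable ?_
    have h : ∀ i, ⇑(Morse.mono ((m * N i : ℕ) : ℤ)) ∘ (fun z : Circle => z ^ t) =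
        Morse.mono ((t * m * N i : ℕ) : ℤ) := fun i => by
      ext z
      simp only [Function.comp_apply, Morse.mono_apply, zpow_natCast, ← pow_mul, mul_assoc]
    simp only [h]
    exact hN (t * m)
  exact Morse.mutuallySingular_of_hasWeakLimit (key r) (key s) (by exact_mod_cast hm)
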